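/- **Setting.** Let $\mathcal X\subseteq\mathbb R^{n}$ be open, $f:\mathcal X\to\mathbb R^{n}$ and $B:\mathcal X\to\mathbb R^{n\times m}$ be $C^1$, $g(x,u)=f(x)+B(x)u$, let $h$ be the true dynamics, and let $M:\mathcal X\to\mathbb S_n^{>0}$ be a $C^1$ Riemannian metric tensor. All norms are 2-norms. For $p,q\in\mathcal X$ let $\mathcal E(p,q)=\mathrm{dist}^2(p,q)$, where $\mathrm{dist}(p,q)$ is the infimum of $\int_0^1\sqrt{c'(s)^\top M(c(s))c'(s)}\,ds$ over smooth curves $c:[0,1]\to\mathcal X$ from $p$ to $q$. Let $(x_i,u_i)$, $i=1,\dots,N$, be training points with training errors $e_i=\|h(x_i,u_i)-g(x_i,u_i)\|$, let $D=\bigcup_i\mathcal B_r(x_i,u_i)$ be the trusted domain, $D_x=\{x:\exists u,\ (x,u)\in D\}\subseteq\mathcal X$ its projection to the state space, and let $L_{h-g}\ge 0$ be a Lipschitz constant of $h-g$ over $D$. Put $\bar\lambda_D(M)=\sup_{x\in D_x}\bar\lambda(M(x))$ and $\underline\lambda_D(M)=\inf_{x\in D_x}\underline\lambda(M(x))$ ($\bar\lambda,\underline\lambda$: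 largest and smallest eigenvalue) and assume $\bar\lambda_D(M)<\infty$, $\underline\lambda_D(M)>0$. Let $\lambda\in\mathbb R$ be a contraction rate. **Trajectories.** On $[0,T)$ let $(x^*(t),u^*(t))\in D$ be a nominal trajectory, $\dot x^*=g(x^*,u^*)$, and let $x(t)$ solve the perturbed system $\dot x=f(x)+B(x)u+d$ (right derivatives suffice), where $$\|d(t)\|\le\min_{1\le i\le N}\Big\{L_{h-g}\Big\|\begin{bmatrix}x(t)\\u(t)\end{bmatrix}-\begin{bmatrix}x_i\\u_i\end{bmatrix}\Big\|+e_i\Big\}\qquad(1)$$ and $\|u(t)-u^*(t)\|\le\bar u_{\mathrm{fb}}(t)$. Assume that for every $t\in[0,T)$ there is a minimizing geodesic $\gamma_t:[0,1]\to\mathcal X$ (smooth, of constant speed, of length $\mathrm{dist}(x^*(t),x(t))$) from $x^*(t)$ to $x(t)$ that lies in $D_x$. **Controller.** The control $u$ is generated by a controller that is contracting with rate $\lambda$ in the metric $M$, in one of the following two senses. Write $\widehat Q=Q+Q^\top$ and $\partial_yQ=\sum_k y^k\,\partial Q/\partial x^k$, and let $B^j$ be the $j$-th column of $B$. (a) $u(t)=\kappa(x(t)-x^*(t),x^*(t),u^*(t))$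 for a feedback law $\kappa(\tilde x,x^*,u^*)$ and there is $\epsilon_{\max}$ such that: $\kappa(0,x^*,u^*)=u^*$ for all $(x^*,u^*)\in D$; for all $(x^*,u^*)\in D$ and $\|\tilde x\|<\epsilon_{\max}$ with $x=x^*+\tilde x\in D_x$, $\kappa$ is differentiable in its first argument at $\tilde x$ and $$\dot M+\widehat{M(A+BK)}+2\lambda M\prec0\quad\text{at }x,$$ where $A=\frac{\partial f}{\partial x}+\sum_j\kappa^j\frac{\partial B^j}{\partial x}$, $K=\frac{\partial\kappa}{\partial\tilde x}$, $\dot M=\partial_{f+B\kappa}M$, and $\kappa=\kappa(\tilde x,x^*,u^*)$; and $\|\gamma_t(s)-x^*(t)\|<\epsilon_{\max}$ for all $t\in[0,T)$, $s\in[0,1]$. (b) With $W=M^{-1}$ and, for some fixed $k$ and each $x\in D_x$, an $n\times k$ matrix $B_\perp(x)$ whose columns form a basis of the null space of $B(x)^\top$, for all $x\in D_x$ and all $j$ $$B_\perp^\top\Big(-\partial_fW+\widehat{\tfrac{\partial f}{\partial x}W}+2\lambda W\Big)B_\perp\preceq0,\qquad B_\perp^\top\Big(\partial_{B^j}W-\widehat{\tfrac{\partial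 B^j}{\partial x}W}\Big)B_\perp=0,$$ and for every $t\in[0,T)$, provided some $v\in\mathbb R^m$ satisfies $$2\gamma_t'(1)^\top M(x(t))\,g\big(x(t),u^*(t)+v\big)-2\gamma_t'(0)^\top M(x^*(t))\,g\big(x^*(t),u^*(t)\big)\le-2\lambda\,\mathcal E(x^*(t),x(t)),$$ $u(t)-u^*(t)$ is such a $v$ of least norm. **Claim.** Let $\mathcal E(t)=\mathcal E(x^*(t),x(t))$ and $D^+\mathcal E(t)=\limsup_{s\to0^+}\frac{\mathcal E(t+s)-\mathcal E(t)}{s}$. For every $t\in[0,T)$, $$D^+\mathcal E(t)\le-2\Big(\lambda-L_{h-g}\sqrt{\tfrac{\bar\lambda_D(M)}{\underline\lambda_D(M)}}\Big)\mathcal E(t)+2\sqrt{\mathcal E(t)\bar\lambda_D(M)}\Big(L_{h-g}\Big(\Big\|\begin{bmatrix}x^*(t)\\u^*(t)\end{bmatrix}-\begin{bmatrix}x_{i^*(t)}\\u_{i^*(t)}\end{bmatrix}\Big\|+\bar u_{\mathrm{fb}}(t)\Big)+e_{i^*(t)}\Big),$$ where $i^*(t)$ is any index achieving the minimum in (1),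 and also where $i^*(t)$ is any index minimizing $L_{h-g}\|(x^*(t),u^*(t))-(x_i,u_i)\|+e_i$. -/

import Mathlib

open Set Filter Topology
open scoped NNReal ContDiff Matrix

noncomputable section

namespace CCM

/-- `ℝⁿ` with the Euclidean norm. -/
abbrev Vec (n : ℕ) := EuclideanSpace ℝ (Fin n)

/-- State-control pairs, with the Euclidean norm of the stacked vector. -/
abbrev Pair (n m : ℕ) := WithLp 2 (Vec n × Vec m)

/-- The stacked vector `(x, u)`. -/
def pair {n m : ℕ} (x : Vec n) (u : Vec m) : Pair n m := WithLp.toLp 2 (x, u)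

/-- Matrix times vector, as a map of Euclidean spaces. -/
def mulV {n m : ℕ} (A : Matrix (Fin n) (Fin m) ℝ) (v : Vec m) : Vec n :=
  WithLp.toLp 2 (A *ᵥ WithLp.ofLp v)

/-! ### Matrix calculus -/

/-- The symmetrization `Q + Qᵀ`. -/
def symmz {n : ℕ} (Q : Matrix (Fin n) (Fin n) ℝ) : Matrix (Fin n) (Fin n) ℝ := Q + Qᵀ

/-- The Jacobian matrix of `φ` at `x`. -/
def jac {n m : ℕ} (φ : Vec n → Vec m) (x : Vec n) : Matrix (Fin m) (Fin n) ℝ :=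
  Matrix.of fun i j => (fderiv ℝ φ x (EuclideanSpace.single j 1)) i

/-- The entrywise derivative `∂_y Q(x) = ∑ₖ yᵏ ∂Q/∂xᵏ` of a matrix-valued function. -/
def dirDeriv {n : ℕ} (Q : Vec n → Matrix (Fin n) (Fin n) ℝ) (y x : Vec n) :
    Matrix (Fin n) (Fin n) ℝ :=
  Matrix.of fun i j => fderiv ℝ (fun z => Q z i j) x y

/-- The `j`-th column of `B(x)`, as a vector field. -/
def col {n m : ℕ} (B : Vec n → Matrix (Fin n) (Fin m) ℝ) (j : Fin m) (x : Vec n) : Vec n :=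
  WithLp.toLp 2 (fun i => B x i j)

/-- Largest eigenvalue (of a symmetric matrix); `spectrum ℝ Q` is the set of real eigenvalues. -/
def maxEig {n : ℕ} (Q : Matrix (Fin n) (Fin n) ℝ) : ℝ := sSup (spectrum ℝ Q)

/-- Smallest eigenvalue (of a symmetric matrix). -/
def minEig {n : ℕ} (Q : Matrix (Fin n) (Fin n) ℝ) : ℝ := sInf (spectrum ℝ Q)

/-- `sup_{x ∈ S}` of the largest eigenvalue of `M(x)`. -/
def supMaxEig {n : ℕ} (M : Vec n → Matrix (Fin n) (Fin n) ℝ) (S : Set (Vec n)) : ℝ :=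
  sSup ((fun x => maxEig (M x)) '' S)

/-- `inf_{x ∈ S}` of the smallest eigenvalue of `M(x)`. -/
def infMinEig {n : ℕ} (M : Vec n → Matrix (Fin n) (Fin n) ℝ) (S : Set (Vec n)) : ℝ :=
  sInf ((fun x => minEig (M x)) '' S)

/-! ### Riemannian distance and energy on the state space `X` with metric tensor `M` -/

/-- The inner product `vᵀ M(x) w`. -/
def metricInner {n : ℕ} (M : Vec n → Matrix (Fin n) (Fin n) ℝ) (x v w : Vec n) : ℝ :=
  inner ℝ v (mulV (M x) w)

/-- The length `∫₀¹ √(c'(s)ᵀ M(c(s)) c'(s)) ds`. -/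
def curveLength {n : ℕ} (M : Vec n → Matrix (Fin n) (Fin n) ℝ) (c : ℝ → Vec n) : ℝ :=
  ∫ s in (0 : ℝ)..1, Real.sqrt (metricInner M (c s) (deriv c s) (deriv c s))

/-- Smooth curves `[0,1] → X` from `p` to `q`. A smooth curve on `[0,1]` is represented by a smooth
extension to `ℝ`; what happens outside `[0,1]` is irrelevant. -/
def smoothCurves {n : ℕ} (X : Set (Vec n)) (p q : Vec n) : Set (ℝ → Vec n) :=
  {c | ContDiff ℝ ∞ c ∧ c 0 = p ∧ c 1 = q ∧ MapsTo c (Icc 0 1) X}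

/-- Riemannian distance: infimum of the lengths of the smooth curves in `X` from `p` to `q`. -/
def riemDist {n : ℕ} (X : Set (Vec n)) (M : Vec n → Matrix (Fin n) (Fin n) ℝ) (p q : Vec n) : ℝ :=
  sInf (curveLength M '' smoothCurves X p q)

/-- Riemannian energy: the squared Riemannian distance. -/
def riemEnergy {n : ℕ} (X : Set (Vec n)) (M : Vec n → Matrix (Fin n) (Fin n) ℝ) (p q : Vec n) : ℝ :=
  riemDist X M p q ^ 2

/-- A minimizing geodesic from `p` to `q`: a smooth curve that realizes the Riemannian distance,
parametrized on `[0,1]` at constant speed. -/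
def IsMinGeodesic {n : ℕ} (X : Set (Vec n)) (M : Vec n → Matrix (Fin n) (Fin n) ℝ)
    (p q : Vec n) (c : ℝ → Vec n) : Prop :=
  c ∈ smoothCurves X p q ∧
    ∀ s ∈ Icc (0 : ℝ) 1,
      Real.sqrt (metricInner M (c s) (deriv c s) (deriv c s)) = riemDist X M p q

/-- Upper (right) Dini derivative `limsup_{s → 0⁺} (E(t+s) - E(t)) / s`, in `[-∞, ∞]`. -/
def upperDini (E : ℝ → ℝ) (t : ℝ) : EReal :=
  limsup (fun s : ℝ => (((E (t + s) - E t) / s : ℝ) : EReal)) (𝓝[>] 0)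

/-! ### Control-affine model, training data, trusted domain -/

/-- The control-affine model `g(x,u) = f(x) + B(x) u`. -/
def affineModel {n m : ℕ} (f : Vec n → Vec n) (B : Vec n → Matrix (Fin n) (Fin m) ℝ)
    (x : Vec n) (u : Vec m) : Vec n :=
  f x + mulV (B x) u

/-- The trusted domain: union of the open `r`-balls about the training pairs. -/
def trustedDomain {n m N : ℕ} (xd : Fin N → Vec n) (ud : Fin N → Vec m) (r : ℝ) :
    Set (Pair n m) :=
  ⋃ i, Metric.ball (pair (xd i) (ud i)) r

/-- The states that occur in a set of state-control pairs. -/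
def stateProj {n m : ℕ} (D : Set (Pair n m)) : Set (Vec n) :=
  {x | ∃ u : Vec m, pair x u ∈ D}

/-- The training error `eᵢ = ‖h(xᵢ,uᵢ) - g(xᵢ,uᵢ)‖`. -/
def trainErr {n m N : ℕ} (h g : Vec n → Vec m → Vec n) (xd : Fin N → Vec n) (ud : Fin N → Vec m)
    (i : Fin N) : ℝ :=
  ‖h (xd i) (ud i) - g (xd i) (ud i)‖

/-- The error bound `L ‖(x,u) - (xᵢ,uᵢ)‖ + eᵢ` at `z = (x,u)` given by the `i`-th data point. -/
def errBound {n m N : ℕ} (L : ℝ) (h g : Vec n → Vec m → Vec n)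
    (xd : Fin N → Vec n) (ud : Fin N → Vec m) (z : Pair n m) (i : Fin N) : ℝ :=
  L * ‖z - pair (xd i) (ud i)‖ + trainErr h g xd ud i

/-! ### Contracting controllers, first kind: an explicit feedback law `κ(x̃, x*, u*)` -/

/-- `Ṁ + sym(M (A + B K)) + 2 λ M` at the state `x* + x̃`, under the control `κ(x̃, x*, u*)`:
`Ṁ` is the derivative of `M` along the closed-loop model, `A = ∂f/∂x + ∑ᵢ uⁱ ∂Bⁱ/∂x` and
`K = ∂κ/∂x`. -/
def weakLHS {n m : ℕ} (f : Vec n → Vec n) (B : Vec n → Matrix (Fin n) (Fin m) ℝ)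
    (M : Vec n → Matrix (Fin n) (Fin n) ℝ) (lam : ℝ) (κ : Vec n → Vec n → Vec m → Vec m)
    (xt xs : Vec n) (us : Vec m) : Matrix (Fin n) (Fin n) ℝ :=
  let x := xs + xt
  let u := κ xt xs us
  let A := jac f x + ∑ i, u i • jac (col B i) x
  let K := jac (fun y => κ y xs us) xt
  dirDeriv M (affineModel f B x u) x + symmz (M x * (A + B x * K)) + (2 * lam) • M x

/-- `κ` is a tracking controller (it applies `u*` at zero deviation) that is differentiable in the
deviation and satisfies the contraction condition with rate `lam` in the metric `M`, for nominal
pairs in `D`, deviations smaller than `εmax`, and states over `D`. -/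
def IsWeakContracting {n m : ℕ} (f : Vec n → Vec n) (B : Vec n → Matrix (Fin n) (Fin m) ℝ)
    (M : Vec n → Matrix (Fin n) (Fin n) ℝ) (lam : ℝ) (D : Set (Pair n m)) (εmax : ℝ)
    (κ : Vec n → Vec n → Vec m → Vec m) : Prop :=
  ∀ xs us, pair xs us ∈ D →
    κ 0 xs us = us ∧
    ∀ xt, ‖xt‖ < εmax → xs + xt ∈ stateProj D →
      DifferentiableAt ℝ (fun y => κ y xs us) xt ∧ (-weakLHS f B M lam κ xt xs us).PosDef

/-! ### Contracting controllers, second kind: optimization-based, from the dual metric `W = M⁻¹` -/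

/-- The columns of `P` form a basis of the null space of `Q`. -/
def IsNullBasis {a b k : ℕ} (Q : Matrix (Fin a) (Fin b) ℝ) (P : Matrix (Fin b) (Fin k) ℝ) : Prop :=
  LinearIndependent ℝ (fun j => Pᵀ j) ∧
    Submodule.span ℝ (range fun j => Pᵀ j) = LinearMap.ker Q.mulVecLin

/-- The strong contraction conditions on `S`, with `Bp(x) = B_⊥(x)` a matrix whose `k` columns form
a basis of the null space of `B(x)ᵀ`. -/
def StrongConditions {n m k : ℕ} (f : Vec n → Vec n) (B : Vec n → Matrix (Fin n) (Fin m) ℝ)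
    (M : Vec n → Matrix (Fin n) (Fin n) ℝ) (lam : ℝ) (S : Set (Vec n))
    (Bp : Vec n → Matrix (Fin n) (Fin k) ℝ) : Prop :=
  let W := fun x => (M x)⁻¹
  ∀ x ∈ S,
    IsNullBasis (B x)ᵀ (Bp x) ∧
    (-((Bp x)ᵀ * (-dirDeriv W (f x) x + symmz (jac f x * W x) + (2 * lam) • W x) *
        Bp x)).PosSemidef ∧
    ∀ j, (Bp x)ᵀ * (dirDeriv W (col B j x) x - symmz (jac (col B j) x * W x)) * Bp x = 0

/-- The feedback controls `v` for which, by the first variation formula along the geodesic `c` from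
`x*` to `x`, the energy of the unperturbed model decreases at rate at least `2 lam`. -/
def feasibleFeedback {n m : ℕ} (f : Vec n → Vec n) (B : Vec n → Matrix (Fin n) (Fin m) ℝ)
    (M : Vec n → Matrix (Fin n) (Fin n) ℝ) (lam : ℝ) (X : Set (Vec n)) (xs x : Vec n) (us : Vec m)
    (c : ℝ → Vec n) : Set (Vec m) :=
  {v | 2 * metricInner M x (deriv c 1) (affineModel f B x (us + v))
      - 2 * metricInner M xs (deriv c 0) (affineModel f B xs us)
      ≤ -2 * lam * riemEnergy X M xs x}

/-- `v` is the output of the optimization-based controller: the element of least norm of the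
feasible set, whenever that set is nonempty. Feasibility itself is not part of the definition. -/
def IsMinNormFeedback {n m : ℕ} (f : Vec n → Vec n) (B : Vec n → Matrix (Fin n) (Fin m) ℝ)
    (M : Vec n → Matrix (Fin n) (Fin n) ℝ) (lam : ℝ) (X : Set (Vec n)) (xs x : Vec n) (us : Vec m)
    (c : ℝ → Vec n) (v : Vec m) : Prop :=
  (feasibleFeedback f B M lam X xs x us c).Nonempty →
    v ∈ feasibleFeedback f B M lam X xs x us c ∧
      ∀ w ∈ feasibleFeedback f B M lam X xs x us c, ‖v‖ ≤ ‖w‖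

/-! ### The differential inequality -/

/-- Right-hand side of the differential inequality, with energy `E`, `lmax`, `lmin` the extreme
eigenvalues of the metric, `dnom` the distance of the nominal pair to the selected training pair,
`ufb` the feedback bound and `e` the training error of the selected training pair. -/
def energyRHS (lam L lmax lmin E dnom ufb e : ℝ) : ℝ :=
  -2 * (lam - L * Real.sqrt (lmax / lmin)) * E
    + 2 * Real.sqrt (E * lmax) * (L * (dnom + ufb) + e)

end CCM

end

/-! The squared distance need not be differentiable, but only an upper bound on a right Dini
derivative is needed. At time `t`, bend the minimizing geodesic by linear interpolation of the
endpoint displacements. By Cauchy-Schwarz the energies of these competitors dominate the squared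
distances at nearby later times, with equality at `t` because the geodesic has constant speed. Their
derivative is the first variation, and the Euler-Lagrange equation reduces it to boundary terms:
`2⟨momentum, velocity⟩` at the executed end minus the same at the nominal end
(`upperDini_le_of_eulerLagrange`).

The executed velocity is the model velocity plus `d`. The model part is at most `-2λE`. For a
feedback law, this follows by integrating the contraction inequality for the closed-loop field along
the geodesic (`boundary_le_of_eulerLagrange`).

For the optimization-based controller it is the constraint itself, so the point is feasibility. If
the final momentum pairs nontrivially with some column of `B`, a multiple of that input suffices.
Otherwise the pairings of momentum with the columns satisfy an equation along the geodesic whose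
right-hand side is quadratic in the velocity and vanishes wherever the pairings do. Constant rank
makes it Lipschitz in the pairings, so by Grönwall they vanish on the whole geodesic
(`eqOn_zero_of_quadratic_deriv`). The drift condition then holds at every point, and zero feedback
is feasible (`drift_boundary_le`).

The disturbance part is at most `2√E √λ̄ ‖d‖` by Cauchy-Schwarz in the metric. The error bound at
`x` is moved to `x*` by the triangle inequality and `‖x - x*‖ ≤ √(E/λ̲)`; the latter produces the
loss `L√(λ̄/λ̲)` in the rate. -/

noncomputable section

namespace CCM

open MeasureTheory

/-! ### Integrals over the unit interval. -/

section Calculus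

/-- Differentiation under the integral sign over `[0,1]`, for a `C¹` integrand. -/
theorem hasFDerivAt_integral_of_contDiffOn {P : Type*} [NormedAddCommGroup P] [NormedSpace ℝ P]
    {q : P × ℝ → ℝ} {O : Set (P × ℝ)} (hO : IsOpen O) (hq : ContDiffOn ℝ 1 q O) {y₀ : P}
    (hy₀ : ∀ σ ∈ Icc (0 : ℝ) 1, (y₀, σ) ∈ O) :
    HasFDerivAt (fun y => ∫ σ in (0 : ℝ)..1, q (y, σ))
      (∫ σ in (0 : ℝ)..1, (fderiv ℝ q (y₀, σ)).comp (ContinuousLinearMap.inl ℝ P ℝ)) y₀ := by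
  have hdc : ContinuousOn (fderiv ℝ q) O := hq.continuousOn_fderiv_of_isOpen hO le_rfl
  have hcurve : ContinuousOn (fun σ : ℝ => fderiv ℝ q (y₀, σ)) (Icc 0 1) :=
    hdc.comp (by fun_prop) hy₀
  obtain ⟨C, hC⟩ := isCompact_Icc.exists_bound_of_continuousOn hcurve
  -- The derivative is bounded by `C` over `{y₀} × [0,1]`. By compactness the bound `C + 1` persists
  -- for `y` near `y₀`, uniformly in `σ`, and serves as the dominating constant.
  have hop : IsOpen (O ∩ (fun p => ‖fderiv ℝ q p‖) ⁻¹' Iio (C + 1)) :=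
    hdc.norm.isOpen_inter_preimage hO isOpen_Iio
  obtain ⟨u, v, hu, -, hyu, hv, huv⟩ := generalized_tube_lemma (isCompact_singleton (x := y₀))
    (isCompact_Icc (a := (0 : ℝ)) (b := 1)) hop (by
      rintro ⟨y, σ⟩ ⟨rfl, hσ⟩
      exact ⟨hy₀ σ hσ, lt_of_le_of_lt (hC σ hσ) (lt_add_one C)⟩)
  have hu0 : u ∈ 𝓝 y₀ := hu.mem_nhds (hyu rfl)
  have hmem : ∀ y ∈ u, ∀ σ ∈ Icc (0 : ℝ) 1, (y, σ) ∈ O ∧ ‖fderiv ℝ q (y, σ)‖ < C + 1 :=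
    fun y hy σ hσ => huv ⟨hy, hv hσ⟩
  have hqc : ∀ y ∈ u, ContinuousOn (fun σ : ℝ => q (y, σ)) (Icc 0 1) := fun y hy =>
    hq.continuousOn.comp (by fun_prop) fun σ hσ => (hmem y hy σ hσ).1
  have hsub : uIoc (0 : ℝ) 1 ⊆ Icc 0 1 := by
    rw [uIoc_of_le zero_le_one]; exact Ioc_subset_Icc_self
  refine intervalIntegral.hasFDerivAt_integral_of_dominated_of_fderiv_le (bound := fun _ => C + 1)
    (F' := fun y σ => (fderiv ℝ q (y, σ)).comp (ContinuousLinearMap.inl ℝ P ℝ)) hu0 ?_ ?_ ?_ ?_ ?_ ?_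
  · filter_upwards [hu0] with y hy
    exact ((hqc y hy).mono hsub).aestronglyMeasurable measurableSet_uIoc
  · exact ContinuousOn.intervalIntegrable_of_Icc zero_le_one (hqc y₀ (hyu rfl))
  · refine ContinuousOn.aestronglyMeasurable ?_ measurableSet_uIoc
    exact (ContinuousOn.clm_comp hcurve continuousOn_const).mono hsub
  · refine Eventually.of_forall fun σ hσ y hy => ?_
    calc _ ≤ ‖fderiv ℝ q (y, σ)‖ * ‖ContinuousLinearMap.inl ℝ P ℝ‖ :=
          ContinuousLinearMap.opNorm_comp_le _ _
      _ ≤ ‖fderiv ℝ q (y, σ)‖ * 1 := by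
          gcongr; exact ContinuousLinearMap.norm_inl_le_one ℝ P ℝ
      _ ≤ C + 1 := by rw [mul_one]; exact (hmem y hy σ (hsub hσ)).2.le
  · exact intervalIntegrable_const
  · refine Eventually.of_forall fun σ hσ y hy => ?_
    have h1 : HasFDerivAt q (fderiv ℝ q (y, σ)) (y, σ) :=
      ((hq.contDiffAt (hO.mem_nhds (hmem y hy σ (hsub hσ)).1)).differentiableAt
        one_ne_zero).hasFDerivAt
    exact h1.comp y (hasFDerivAt_prodMk_left y σ)

/-- The square of the integral over `[0,1]` is at most the integral of the square. -/
theorem sq_integral_le_integral_sq {w : ℝ → ℝ} (hw : ContinuousOn w (Icc 0 1)) :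
    (∫ s in (0 : ℝ)..1, w s) ^ 2 ≤ ∫ s in (0 : ℝ)..1, w s ^ 2 := by
  set a := ∫ s in (0 : ℝ)..1, w s with ha
  have h1 : IntervalIntegrable w volume 0 1 := hw.intervalIntegrable_of_Icc zero_le_one
  have h2 : IntervalIntegrable (fun s => w s ^ 2) volume 0 1 :=
    (hw.pow 2).intervalIntegrable_of_Icc zero_le_one
  -- The variance of `w` is nonnegative.
  have h3 : 0 ≤ ∫ s in (0 : ℝ)..1, (w s - a) ^ 2 :=
    intervalIntegral.integral_nonneg zero_le_one fun s _ => sq_nonneg _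
  have h4 : ∫ s in (0 : ℝ)..1, (w s - a) ^ 2
      = (∫ s in (0 : ℝ)..1, w s ^ 2) - 2 * a * a + a ^ 2 := by
    have : (fun s => (w s - a) ^ 2) = fun s => w s ^ 2 - (2 * a) * w s + a ^ 2 := by
      funext s; ring
    rw [this, intervalIntegral.integral_add (h2.sub (h1.const_mul _)) intervalIntegrable_const,
      intervalIntegral.integral_sub h2 (h1.const_mul _), intervalIntegral.integral_const_mul, ← ha]
    simp
  nlinarith

/-- A function continuous on `[0,1]` that integrates to zero against test functions supported in
`(0,1)` vanishes on `[0,1]`. -/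
theorem eqOn_zero_of_integral_mul_eq_zero {k : ℝ → ℝ} (hk : ContinuousOn k (Icc 0 1))
    (h : ∀ φ : ℝ → ℝ, ContDiff ℝ ∞ φ → φ 0 = 0 → φ 1 = 0 →
      ∫ s in (0 : ℝ)..1, φ s * k s = 0) : ∀ s ∈ Icc (0 : ℝ) 1, k s = 0 := by
  have hae : ∀ᵐ s ∂(volume : Measure ℝ), s ∈ Ioo (0 : ℝ) 1 → k s = 0 := by
    refine isOpen_Ioo.ae_eq_zero_of_integral_contDiff_smul_eq_zero
      ((hk.mono Ioo_subset_Icc_self).locallyIntegrableOn measurableSet_Ioo) ?_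
    intro φ hφ _ hsupp
    have hz : ∀ s, s ∉ Ioo (0 : ℝ) 1 → φ s = 0 := fun s hs =>
      image_eq_zero_of_notMem_tsupport fun hs' => hs (hsupp hs')
    have h0 := h φ hφ (hz 0 (by simp)) (hz 1 (by simp))
    rw [intervalIntegral.integral_of_le zero_le_one] at h0
    rw [← h0]
    symm
    refine setIntegral_eq_integral_of_forall_compl_eq_zero fun s hs => ?_
    rw [hz s fun hs' => hs (Ioo_subset_Ioc_self hs'), zero_mul]
  have hres : k =ᵐ[volume.restrict (Icc 0 1)] fun _ => 0 := by
    rw [← restrict_Ioo_eq_restrict_Icc]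
    exact (ae_restrict_iff' measurableSet_Ioo).2 hae
  exact Measure.eqOn_Icc_of_ae_eq volume zero_ne_one hres hk continuousOn_const

end Calculus

theorem one_add_one_le_smooth : (1 + 1 : WithTop ℕ∞) ≤ ∞ := by
  have h : ((2 : ℕ∞) : WithTop ℕ∞) ≤ ((⊤ : ℕ∞) : WithTop ℕ∞) := WithTop.coe_le_coe.2 le_top
  rw [one_add_one_eq_two]
  exact h

/-! ### First variation of the energy and the Euler-Lagrange equation. -/

section FirstVariation

variable {E : Type*} [NormedAddCommGroup E] [InnerProductSpace ℝ E]

/-- The energy `∫₀¹ ⟨c', G(c) c'⟩` of a curve for the metric given by a field `G` of operators. -/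
def curveEnergy (G : E → E →L[ℝ] E) (c : ℝ → E) : ℝ :=
  ∫ s in (0 : ℝ)..1, inner ℝ (deriv c s) (G (c s) (deriv c s))

/-- The first variation of the energy at the curve `γ` in the direction of the field `v`. -/
def firstVariation (G : E → E →L[ℝ] E) (γ v : ℝ → E) : ℝ :=
  ∫ s in (0 : ℝ)..1, (inner ℝ (deriv γ s) (fderiv ℝ G (γ s) (v s) (deriv γ s))
    + 2 * inner ℝ (G (γ s) (deriv γ s)) (deriv v s))

/-- The momentum `G(γ) γ'` of a curve. -/
def momentum (G : E → E →L[ℝ] E) (γ : ℝ → E) (s : ℝ) : E := G (γ s) (deriv γ s)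

/-- The energy of the variation `γ + A y` is differentiable in the parameter `y`, with derivative
given by the first variation. -/
theorem exists_hasFDerivAt_curveEnergy {P : Type*} [NormedAddCommGroup P] [NormedSpace ℝ P]
    {X : Set E} (hX : IsOpen X) {G : E → E →L[ℝ] E} (hG : ContDiffOn ℝ 1 G X)
    (hs : ∀ x ∈ X, ∀ v w, inner ℝ (G x v) w = inner ℝ v (G x w))
    {γ : ℝ → E} (hγ : ContDiff ℝ ∞ γ) (hγX : MapsTo γ (Icc 0 1) X)
    {A : ℝ → P →L[ℝ] E} (hA : ContDiff ℝ ∞ A) :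
    ∃ Λ : P →L[ℝ] ℝ,
      HasFDerivAt (fun y => curveEnergy G fun s => γ s + A s y) Λ 0 ∧
      ∀ y, Λ y = firstVariation G γ fun s => A s y := by
  have hdγ : ContDiff ℝ 1 (deriv γ) := (hγ.of_le one_add_one_le_smooth).deriv'
  have hdA : ContDiff ℝ 1 (deriv A) := (hA.of_le one_add_one_le_smooth).deriv'
  have hγ1 : ContDiff ℝ 1 γ := hγ.of_le (by simp)
  have hA1 : ContDiff ℝ 1 A := hA.of_le (by simp)
  have hderA : ∀ y s, HasDerivAt (fun s => A s y) (deriv A s y) s := fun y s =>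
    ((hA1.differentiable one_ne_zero s).hasDerivAt).clm_apply (hasDerivAt_const s y) |>.congr_deriv
      (by simp)
  have hder : ∀ y s, deriv (fun s => γ s + A s y) s = deriv γ s + deriv A s y := fun y s =>
    ((hγ1.differentiable one_ne_zero s).hasDerivAt.add (hderA y s)).deriv
  -- Position and velocity of the varied curve, jointly in the parameter and the time; the integrand
  -- is then jointly `C¹`.
  set Φ : P × ℝ → E := fun p => γ p.2 + A p.2 p.1 with hΦ
  set Ψ : P × ℝ → E := fun p => deriv γ p.2 + deriv A p.2 p.1 with hΨ
  have hΦ1 : ContDiff ℝ 1 Φ := (hγ1.comp contDiff_snd).add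
    ((hA1.comp contDiff_snd).clm_apply contDiff_fst)
  have hΨ1 : ContDiff ℝ 1 Ψ := (hdγ.comp contDiff_snd).add
    ((hdA.comp contDiff_snd).clm_apply contDiff_fst)
  set q : P × ℝ → ℝ := fun p => inner ℝ (Ψ p) (G (Φ p) (Ψ p)) with hq
  set O : Set (P × ℝ) := Φ ⁻¹' X with hOdef
  have hO : IsOpen O := hX.preimage hΦ1.continuous
  have hq1 : ContDiffOn ℝ 1 q O :=
    hΨ1.contDiffOn.inner ℝ ((hG.comp hΦ1.contDiffOn fun p hp => hp).clm_apply hΨ1.contDiffOn)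
  have h0O : ∀ s ∈ Icc (0 : ℝ) 1, ((0 : P), s) ∈ O := fun s hs => by
    simpa [hOdef, hΦ] using hγX hs
  have key := hasFDerivAt_integral_of_contDiffOn hO hq1 h0O
  refine ⟨∫ s in (0 : ℝ)..1, (fderiv ℝ q ((0 : P), s)).comp (ContinuousLinearMap.inl ℝ P ℝ),
    ?_, fun y => ?_⟩
  · refine key.congr_of_eventuallyEq (Eventually.of_forall fun y => ?_)
    simp only [curveEnergy, hder, hq, hΦ, hΨ]
  · have hcont : ContinuousOn (fun s : ℝ => (fderiv ℝ q ((0 : P), s)).comp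
        (ContinuousLinearMap.inl ℝ P ℝ)) (Icc 0 1) :=
      ((hq1.continuousOn_fderiv_of_isOpen hO le_rfl).comp (by fun_prop) h0O).clm_comp
        continuousOn_const
    rw [ContinuousLinearMap.intervalIntegral_apply (hcont.intervalIntegrable_of_Icc zero_le_one)]
    refine intervalIntegral.integral_congr fun s hs' => ?_
    rw [uIcc_of_le zero_le_one] at hs'
    have hγs : γ s ∈ X := hγX hs'
    -- The partial derivative is identified by differentiating along the ray `ε ↦ ε y`, where the
    -- product rule applies.
    have e1 : HasDerivAt (fun ε : ℝ => q (ε • y, s))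
        ((fderiv ℝ q ((0 : P), s)).comp (ContinuousLinearMap.inl ℝ P ℝ) y) 0 := by
      have h1 : HasFDerivAt q (fderiv ℝ q ((0 : P), s)) ((0 : P), s) :=
        ((hq1.contDiffAt (hO.mem_nhds (h0O s hs'))).differentiableAt one_ne_zero).hasFDerivAt
      have h2 : HasDerivAt (fun ε : ℝ => (ε • y, s)) (y, (0 : ℝ)) 0 := by
        simpa using ((hasDerivAt_id (0 : ℝ)).smul_const y).prodMk (hasDerivAt_const (0 : ℝ) s)
      have h1' : HasFDerivAt q (fderiv ℝ q ((0 : P), s)) ((0 : ℝ) • y, s) := by simpa using h1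
      exact h1'.comp_hasDerivAt (0 : ℝ) h2
    have lin : ∀ a b : E, HasDerivAt (fun ε : ℝ => a + ε • b) b 0 := fun a b => by
      simpa using ((hasDerivAt_id (0 : ℝ)).smul_const b).const_add a
    have hGd : HasFDerivAt G (fderiv ℝ G (γ s)) (γ s + (0 : ℝ) • A s y) := by
      simpa using ((hG.contDiffAt (hX.mem_nhds hγs)).differentiableAt one_ne_zero).hasFDerivAt
    have l1 := lin (deriv γ s) (deriv A s y)
    have l2 : HasDerivAt (fun ε : ℝ => G (γ s + ε • A s y)) (fderiv ℝ G (γ s) (A s y)) 0 :=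
      hGd.comp_hasDerivAt (0 : ℝ) (lin (γ s) (A s y))
    have e2 := l1.inner ℝ (l2.clm_apply l1)
    have e3 : (fun ε : ℝ => q (ε • y, s)) = fun ε : ℝ =>
        inner ℝ (deriv γ s + ε • deriv A s y)
          (G (γ s + ε • A s y) (deriv γ s + ε • deriv A s y)) := by
      funext ε; simp [hq, hΦ, hΨ]
    rw [e3] at e1
    simp only [e1.unique e2, (hderA y s).deriv, zero_smul, add_zero, inner_add_right,
      hs _ hγs]
    -- Symmetry of `G` makes the two terms containing `deriv A s y` equal, whence the factor 2.
    rw [real_inner_comm (G (γ s) (deriv γ s)) (deriv A s y), hs _ hγs]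
    ring

variable {X : Set E} {G : E → E →L[ℝ] E} {γ : ℝ → E}

theorem contDiffOn_momentum (hG : ContDiffOn ℝ 1 G X) (hγ : ContDiff ℝ ∞ γ) :
    ContDiffOn ℝ 1 (momentum G γ) (γ ⁻¹' X) := by
  have hdγ : ContDiff ℝ 1 (deriv γ) := (hγ.of_le one_add_one_le_smooth).deriv'
  have hγ1 : ContDiff ℝ 1 γ := hγ.of_le (by simp)
  exact (hG.comp hγ1.contDiffOn fun p hp => hp).clm_apply hdγ.contDiffOn

theorem hasDerivAt_momentum (hX : IsOpen X) (hG : ContDiffOn ℝ 1 G X) (hγ : ContDiff ℝ ∞ γ)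
    {s : ℝ} (hs : γ s ∈ X) : HasDerivAt (momentum G γ) (deriv (momentum G γ) s) s :=
  (((contDiffOn_momentum hG hγ).contDiffAt
    ((hX.preimage hγ.continuous).mem_nhds hs)).differentiableAt one_ne_zero).hasDerivAt

theorem continuousOn_deriv_momentum (hX : IsOpen X) (hG : ContDiffOn ℝ 1 G X)
    (hγ : ContDiff ℝ ∞ γ) : ContinuousOn (deriv (momentum G γ)) (γ ⁻¹' X) :=
  (contDiffOn_momentum hG hγ).continuousOn_deriv_of_isOpen (hX.preimage hγ.continuous) le_rfl

/-- Integration by parts in the first variation. -/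
theorem firstVariation_eq (hX : IsOpen X) (hG : ContDiffOn ℝ 1 G X)
    (hγ : ContDiff ℝ ∞ γ) (hγX : MapsTo γ (Icc 0 1) X) {v : ℝ → E} (hv : ContDiff ℝ ∞ v) :
    firstVariation G γ v =
      2 * inner ℝ (momentum G γ 1) (v 1) - 2 * inner ℝ (momentum G γ 0) (v 0)
      + ∫ s in (0 : ℝ)..1, (inner ℝ (deriv γ s) (fderiv ℝ G (γ s) (v s) (deriv γ s))
        - 2 * inner ℝ (deriv (momentum G γ) s) (v s)) := by
  have hdγ : Continuous (deriv γ) := hγ.continuous_deriv (by simp)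
  have hdv : Continuous (deriv v) := hv.continuous_deriv (by simp)
  have hv' : ∀ s, HasDerivAt v (deriv v s) s := fun s =>
    (hv.differentiable (by simp) s).hasDerivAt
  have hη : ContinuousOn (momentum G γ) (Icc 0 1) :=
    (contDiffOn_momentum hG hγ).continuousOn.mono hγX
  have hη' : ContinuousOn (deriv (momentum G γ)) (Icc 0 1) :=
    (continuousOn_deriv_momentum hX hG hγ).mono hγX
  have hDG : ContinuousOn (fun s => fderiv ℝ G (γ s)) (Icc 0 1) :=
    (hG.continuousOn_fderiv_of_isOpen hX le_rfl).comp hγ.continuous.continuousOn hγX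
  have c1 : ContinuousOn (fun s => inner ℝ (deriv γ s) (fderiv ℝ G (γ s) (v s) (deriv γ s)))
      (Icc 0 1) :=
    hdγ.continuousOn.inner ((hDG.clm_apply hv.continuous.continuousOn).clm_apply hdγ.continuousOn)
  have c2 : ContinuousOn (fun s => inner ℝ (momentum G γ s) (deriv v s)) (Icc 0 1) :=
    hη.inner hdv.continuousOn
  have c3 : ContinuousOn (fun s => inner ℝ (deriv (momentum G γ) s) (v s)) (Icc 0 1) :=
    hη'.inner hv.continuous.continuousOn
  have ftc : ∫ s in (0 : ℝ)..1, (2 * inner ℝ (momentum G γ s) (deriv v s)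
      + 2 * inner ℝ (deriv (momentum G γ) s) (v s)) =
      2 * inner ℝ (momentum G γ 1) (v 1) - 2 * inner ℝ (momentum G γ 0) (v 0) := by
    refine intervalIntegral.integral_eq_sub_of_hasDerivAt
      (f := fun s => 2 * inner ℝ (momentum G γ s) (v s)) (fun s hs => ?_) ?_
    · rw [uIcc_of_le zero_le_one] at hs
      refine (((hasDerivAt_momentum hX hG hγ (hγX hs)).inner ℝ (hv' s)).const_mul 2).congr_deriv ?_
      ring
    · exact ((continuousOn_const.mul c2).add
        (continuousOn_const.mul c3)).intervalIntegrable_of_Icc zero_le_one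
  rw [← ftc, firstVariation, ← intervalIntegral.integral_add]
  · refine intervalIntegral.integral_congr fun s _ => ?_
    simp only [momentum]
    ring
  · exact ((continuousOn_const.mul c2).add
      (continuousOn_const.mul c3)).intervalIntegrable_of_Icc zero_le_one
  · exact (c1.sub (continuousOn_const.mul c3)).intervalIntegrable_of_Icc zero_le_one

/-- The Euler-Lagrange equation of a curve at which the first variation vanishes. -/
theorem eulerLagrange_of_firstVariation_eq_zero (hX : IsOpen X) (hG : ContDiffOn ℝ 1 G X)
    (hγ : ContDiff ℝ ∞ γ) (hγX : MapsTo γ (Icc 0 1) X)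
    (hcrit : ∀ v : ℝ → E, ContDiff ℝ ∞ v → v 0 = 0 → v 1 = 0 → firstVariation G γ v = 0) :
    ∀ s ∈ Icc (0 : ℝ) 1, ∀ w : E, inner ℝ (deriv γ s) (fderiv ℝ G (γ s) w (deriv γ s))
      = 2 * inner ℝ (deriv (momentum G γ) s) w := by
  intro s hs w
  have hdγ : Continuous (deriv γ) := hγ.continuous_deriv (by simp)
  have hη' : ContinuousOn (deriv (momentum G γ)) (Icc 0 1) :=
    (continuousOn_deriv_momentum hX hG hγ).mono hγX
  have hDG : ContinuousOn (fun s => fderiv ℝ G (γ s)) (Icc 0 1) :=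
    (hG.continuousOn_fderiv_of_isOpen hX le_rfl).comp hγ.continuous.continuousOn hγX
  have hk : ContinuousOn (fun s => inner ℝ (deriv γ s) (fderiv ℝ G (γ s) w (deriv γ s))
      - 2 * inner ℝ (deriv (momentum G γ) s) w) (Icc 0 1) :=
    (hdγ.continuousOn.inner ((hDG.clm_apply continuousOn_const).clm_apply
      hdγ.continuousOn)).sub (continuousOn_const.mul (hη'.inner continuousOn_const))
  -- The test fields `φ • w`, with `w` fixed and `φ` vanishing at both ends, have no boundary terms
  -- and reduce the claim to the scalar fundamental lemma.
  refine sub_eq_zero.1 (eqOn_zero_of_integral_mul_eq_zero hk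
    (fun φ (hφ : ContDiff ℝ ∞ φ) h0 h1 => ?_) s hs)
  have hv : ContDiff ℝ ∞ fun s => φ s • w := hφ.smul (contDiff_const (c := w))
  have := hcrit _ hv (by simp [h0]) (by simp [h1])
  rw [firstVariation_eq hX hG hγ hγX hv] at this
  simp only [h0, h1, zero_smul, inner_zero_right, mul_zero, sub_zero, zero_add] at this
  refine Eq.trans (intervalIntegral.integral_congr fun s _ => ?_) this
  simp only [map_smul, _root_.smul_apply, inner_smul_right]
  ring

end FirstVariation

/-- A function that is locally dominated by a function with a right derivative, with equality at
the base point, has its upper Dini derivative bounded by that right derivative. -/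
theorem upperDini_le_of_eventually_le {e F : ℝ → ℝ} {F' t : ℝ}
    (hF : HasDerivWithinAt F F' (Ici t) t) (hle : ∀ᶠ τ in 𝓝[≥] t, e τ ≤ F τ) (heq : e t = F t) :
    upperDini e t ≤ (F' : EReal) := by
  have hshift : Tendsto (fun s : ℝ => t + s) (𝓝[>] 0) (𝓝[>] t) := by
    refine tendsto_nhdsWithin_of_tendsto_nhds_of_eventually_within _ ?_ ?_
    · have : Tendsto (fun s : ℝ => t + s) (𝓝 0) (𝓝 (t + 0)) := by
        exact (continuous_const.add continuous_id).tendsto 0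
      rw [add_zero] at this
      exact this.mono_left nhdsWithin_le_nhds
    · filter_upwards [self_mem_nhdsWithin] with s hs
      exact lt_add_of_pos_right t hs
  have hslope : Tendsto (fun s : ℝ => (F (t + s) - F t) / s) (𝓝[>] 0) (𝓝 F') := by
    have h1 := (hasDerivWithinAt_iff_tendsto_slope' (by simp)).1
      (hF.mono Ioi_subset_Ici_self)
    refine (h1.comp hshift).congr fun s => ?_
    simp [slope_def_field]
  have hE : Tendsto (fun s : ℝ => (((F (t + s) - F t) / s : ℝ) : EReal)) (𝓝[>] 0)
      (𝓝 (F' : EReal)) := (continuous_coe_real_ereal.tendsto F').comp hslope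
  rw [← hE.limsup_eq]
  refine limsup_le_limsup ?_
  have hle' := hshift.eventually (hle.filter_mono (nhdsWithin_mono t Ioi_subset_Ici_self))
  filter_upwards [hle', self_mem_nhdsWithin] with s hs hs0
  have hs0' : (0 : ℝ) < s := hs0
  rw [EReal.coe_le_coe_iff, heq]
  gcongr

/-! ### Minimizing curves and the Dini derivative of the minimal energy. -/

section Minimizing

variable {E : Type*} [NormedAddCommGroup E] [InnerProductSpace ℝ E]
  {X : Set E} {G : E → E →L[ℝ] E} {γ : ℝ → E}

/-- Compactness of `[0,1]` keeps small variations inside the open set, so that they are admissible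
competitors. -/
theorem eventually_mapsTo_variation {P : Type*} [NormedAddCommGroup P] [NormedSpace ℝ P]
    (hX : IsOpen X) (hγ : ContDiff ℝ ∞ γ) (hγX : MapsTo γ (Icc 0 1) X)
    {A : ℝ → P →L[ℝ] E} (hA : ContDiff ℝ ∞ A) :
    ∀ᶠ y in 𝓝 (0 : P), MapsTo (fun s => γ s + A s y) (Icc 0 1) X := by
  have hc : Continuous fun p : P × ℝ => γ p.2 + A p.2 p.1 :=
    (hγ.continuous.comp continuous_snd).add
      ((hA.continuous.comp continuous_snd).clm_apply continuous_fst)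
  refine isCompact_Icc.eventually_forall_of_forall_eventually fun s hs => ?_
  refine hc.continuousAt.eventually_mem (hX.mem_nhds ?_)
  simpa using hγX hs

theorem contDiff_segment_clm {P : Type*} [NormedAddCommGroup P] [NormedSpace ℝ P]
    (a b : P →L[ℝ] E) : ContDiff ℝ ∞ fun s : ℝ => (1 - s) • a + s • b :=
  ((contDiff_const.sub contDiff_id).smul contDiff_const).add (contDiff_id.smul contDiff_const)

/-- The first variation vanishes at an energy minimizing curve. -/
theorem firstVariation_eq_zero_of_minimizing (hX : IsOpen X) (hG : ContDiffOn ℝ 1 G X)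
    (hs : ∀ x ∈ X, ∀ v w, inner ℝ (G x v) w = inner ℝ v (G x w))
    (hγ : ContDiff ℝ ∞ γ) (hγX : MapsTo γ (Icc 0 1) X)
    (hmin : ∀ c : ℝ → E, ContDiff ℝ ∞ c → c 0 = γ 0 → c 1 = γ 1 → MapsTo c (Icc 0 1) X →
      curveEnergy G γ ≤ curveEnergy G c)
    {v : ℝ → E} (hv : ContDiff ℝ ∞ v) (h0 : v 0 = 0) (h1 : v 1 = 0) :
    firstVariation G γ v = 0 := by
  -- The one-parameter variation `γ + y v`, which fixes both endpoints; evaluation at `y = 1`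
  -- recovers `v`.
  set A : ℝ → ℝ →L[ℝ] E := fun s => (1 : ℝ →L[ℝ] ℝ).smulRight (v s) with hAdef
  have hA : ContDiff ℝ ∞ A := contDiff_const.smulRight hv
  obtain ⟨Λ, hΛ, hΛv⟩ := exists_hasFDerivAt_curveEnergy hX hG hs hγ hγX hA
  have hloc : IsLocalMin (fun y => curveEnergy G fun s => γ s + A s y) 0 := by
    filter_upwards [eventually_mapsTo_variation hX hγ hγX hA] with y hy
    have hc : ContDiff ℝ ∞ fun s => γ s + A s y := hγ.add (hA.clm_apply contDiff_const)
    simpa using hmin _ hc (by simp [hAdef, h0]) (by simp [hAdef, h1]) hy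
  have hz := hΛv 1
  rw [hloc.hasFDerivAt_eq_zero hΛ] at hz
  simpa [hAdef] using hz.symm

/-- The right Dini derivative of the minimal energy between two moving points is bounded by the
first variation formula along a minimizing geodesic. -/
theorem upperDini_le_of_eulerLagrange (hX : IsOpen X) (hG : ContDiffOn ℝ 1 G X)
    (hs : ∀ x ∈ X, ∀ v w, inner ℝ (G x v) w = inner ℝ v (G x w))
    (hγ : ContDiff ℝ ∞ γ) (hγX : MapsTo γ (Icc 0 1) X)
    (hEL : ∀ s ∈ Icc (0 : ℝ) 1, ∀ w : E, inner ℝ (deriv γ s) (fderiv ℝ G (γ s) w (deriv γ s))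
      = 2 * inner ℝ (deriv (momentum G γ) s) w)
    {e : E → E → ℝ}
    (he : ∀ c : ℝ → E, ContDiff ℝ ∞ c → MapsTo c (Icc 0 1) X → e (c 0) (c 1) ≤ curveEnergy G c)
    (heγ : e (γ 0) (γ 1) = curveEnergy G γ)
    {p q : ℝ → E} {p' q' : E} {t : ℝ} (hpt : p t = γ 0) (hqt : q t = γ 1)
    (hp : HasDerivWithinAt p p' (Ici t) t) (hq : HasDerivWithinAt q q' (Ici t) t) :
    upperDini (fun τ => e (p τ) (q τ)) t ≤
      ((2 * inner ℝ (momentum G γ 1) q' - 2 * inner ℝ (momentum G γ 0) p' : ℝ) : EReal) := by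
  -- Linear interpolation of the two endpoint displacements: `γ + A (p τ - γ 0, q τ - γ 1)` joins `p
  -- τ` to `q τ`, so its energy bounds `e (p τ) (q τ)` from above.
  set A : ℝ → E × E →L[ℝ] E := fun s =>
    (1 - s) • ContinuousLinearMap.fst ℝ E E + s • ContinuousLinearMap.snd ℝ E E with hAdef
  have hA : ContDiff ℝ ∞ A := contDiff_segment_clm _ _
  obtain ⟨Λ, hΛ, hΛv⟩ := exists_hasFDerivAt_curveEnergy hX hG hs hγ hγX hA
  have hy : HasDerivWithinAt (fun τ => (p τ - γ 0, q τ - γ 1)) (p', q') (Ici t) t :=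
    (hp.sub_const _).prodMk (hq.sub_const _)
  have hy0 : (p t - γ 0, q t - γ 1) = (0 : E × E) := by simp [hpt, hqt]
  rw [← hy0] at hΛ
  have hF := hΛ.comp_hasDerivWithinAt t hy
  have hv : ContDiff ℝ ∞ fun s => A s (p', q') := hA.clm_apply contDiff_const
  have hval : Λ (p', q')
      = 2 * inner ℝ (momentum G γ 1) q' - 2 * inner ℝ (momentum G γ 0) p' := by
    rw [hΛv, firstVariation_eq hX hG hγ hγX hv]
    have : ∫ s in (0 : ℝ)..1, (inner ℝ (deriv γ s)
        (fderiv ℝ G (γ s) (A s (p', q')) (deriv γ s))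
        - 2 * inner ℝ (deriv (momentum G γ) s) (A s (p', q'))) = ∫ s in (0 : ℝ)..1, (0 : ℝ) := by
      refine intervalIntegral.integral_congr fun s hs' => ?_
      rw [uIcc_of_le zero_le_one] at hs'
      exact sub_eq_zero.2 (hEL s hs' _)
    rw [this]
    simp [hAdef]
  rw [hval] at hF
  refine upperDini_le_of_eventually_le hF ?_ ?_
  · have hcont : Tendsto (fun τ => (p τ - γ 0, q τ - γ 1)) (𝓝[≥] t) (𝓝 0) := by
      have := hy.continuousWithinAt.tendsto
      rwa [hy0] at this
    filter_upwards [hcont.eventually (eventually_mapsTo_variation hX hγ hγX hA)] with τ hτ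
    have hc : ContDiff ℝ ∞ fun s => γ s + A s (p τ - γ 0, q τ - γ 1) :=
      hγ.add (hA.clm_apply contDiff_const)
    simpa [hAdef] using he _ hc hτ
  · simp only [Function.comp_apply, hy0, map_zero, add_zero]
    rw [hpt, hqt, heγ]

end Minimizing

/-! ### Integrating a contraction inequality along a geodesic. -/

section Contraction

variable {E : Type*} [NormedAddCommGroup E] [InnerProductSpace ℝ E]
  {X : Set E} {G : E → E →L[ℝ] E} {γ : ℝ → E}

/-- If the energy density decreases along a vector field at a rate at least `C`, then so does the
boundary term of the first variation formula. -/
theorem boundary_le_of_eulerLagrange (hX : IsOpen X) (hG : ContDiffOn ℝ 1 G X)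
    (hγ : ContDiff ℝ ∞ γ) (hγX : MapsTo γ (Icc 0 1) X)
    (hEL : ∀ s ∈ Icc (0 : ℝ) 1, ∀ w : E, inner ℝ (deriv γ s) (fderiv ℝ G (γ s) w (deriv γ s))
      = 2 * inner ℝ (deriv (momentum G γ) s) w)
    {v v' : ℝ → E} (hv : ∀ s ∈ Icc (0 : ℝ) 1, HasDerivAt v (v' s) s) {C : ℝ}
    (hC : ∀ s ∈ Icc (0 : ℝ) 1, inner ℝ (deriv γ s) (fderiv ℝ G (γ s) (v s) (deriv γ s))
      + 2 * inner ℝ (momentum G γ s) (v' s) ≤ C) :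
    2 * inner ℝ (momentum G γ 1) (v 1) - 2 * inner ℝ (momentum G γ 0) (v 0) ≤ C := by
  have hd : ∀ s ∈ Icc (0 : ℝ) 1, HasDerivAt (fun s => 2 * inner ℝ (momentum G γ s) (v s))
      (inner ℝ (deriv γ s) (fderiv ℝ G (γ s) (v s) (deriv γ s))
        + 2 * inner ℝ (momentum G γ s) (v' s)) s := fun s hs => by
    refine (((hasDerivAt_momentum hX hG hγ (hγX hs)).inner ℝ (hv s hs)).const_mul 2).congr_deriv ?_
    -- The Euler-Lagrange equation trades the derivative of the momentum for the derivative of the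
    -- metric, so the pairing of momentum with `v` changes at the rate bounded in `hC`.
    rw [hEL s hs]
    ring
  have := (convex_Icc (0 : ℝ) 1).image_sub_le_mul_sub_of_deriv_le
    (f := fun s => 2 * inner ℝ (momentum G γ s) (v s)) (C := C)
    (fun s hs => (hd s hs).continuousAt.continuousWithinAt)
    (fun s hs => (hd s (interior_subset hs)).differentiableAt.differentiableWithinAt)
    (fun s hs => by rw [(hd s (interior_subset hs)).deriv]; exact hC s (interior_subset hs))
    0 (by simp) 1 (by simp) zero_le_one
  simpa using this

end Contraction

/-! ### Constant-rank families and a Grönwall argument. -/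

section ConstantRank

variable {E : Type*} [NormedAddCommGroup E] [InnerProductSpace ℝ E] [FiniteDimensional ℝ E]

/-- For a continuous family of linear maps of constant rank, the distance to the kernel is locally
uniformly controlled by the norm of the image. -/
theorem exists_kernel_approx {F : Type*} [NormedAddCommGroup F] [NormedSpace ℝ F]
    {A : ℝ → E →L[ℝ] F} {I : Set ℝ} (hA : ContinuousOn A I) {k : ℕ}
    (hk : ∀ s ∈ I, Module.finrank ℝ (LinearMap.ker (A s).toLinearMap) = k)
    {s₀ : ℝ} (hs₀ : s₀ ∈ I) :
    ∃ C : ℝ, 0 ≤ C ∧ ∀ᶠ s in 𝓝[I] s₀, ∀ δ, ∃ c, ‖c‖ ≤ C * ‖A s δ‖ ∧ A s (δ - c) = 0 := by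
  set K := LinearMap.ker (A s₀).toLinearMap with hK
  -- `A s₀` is injective on the orthogonal complement of its kernel, hence bounded below there in
  -- finite dimension.
  have hinj : LinearMap.ker ((A s₀).toLinearMap.comp Kᗮ.subtype) = ⊥ := by
    rw [LinearMap.ker_eq_bot']
    intro x hx
    have h1 : (x : E) ∈ K := by simpa [hK] using hx
    have := Submodule.inner_right_of_mem_orthogonal h1 x.2
    exact Subtype.ext (inner_self_eq_zero.1 this)
  obtain ⟨κ, hκ, hanti⟩ := LinearMap.exists_antilipschitzWith _ hinj
  have hlow : ∀ x ∈ Kᗮ, ‖x‖ ≤ κ * ‖A s₀ x‖ := fun x hx => by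
    simpa using hanti.le_mul_dist (⟨x, hx⟩ : Kᗮ) 0
  have hκ' : (0 : ℝ) < κ := hκ
  refine ⟨2 * κ, by positivity, ?_⟩
  -- A perturbation smaller than `1 / (2κ)` costs at most half of `‖x‖`, so the lower bound survives
  -- with `2κ`.
  have hnear : ∀ᶠ s in 𝓝[I] s₀, ‖A s - A s₀‖ < 1 / (2 * κ) := by
    have : Tendsto (fun s => ‖A s - A s₀‖) (𝓝[I] s₀) (𝓝 0) := by
      simpa using ((hA s₀ hs₀).tendsto.sub_const (A s₀)).norm
    exact this.eventually (gt_mem_nhds (by positivity))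
  filter_upwards [hnear, self_mem_nhdsWithin] with s hs hsI
  have hlow' : ∀ x ∈ Kᗮ, ‖x‖ ≤ 2 * κ * ‖A s x‖ := fun x hx => by
    have h1 : ‖A s₀ x‖ ≤ ‖A s x‖ + ‖A s - A s₀‖ * ‖x‖ := by
      have : A s₀ x = A s x - (A s - A s₀) x := by simp
      rw [this]
      exact (norm_sub_le _ _).trans (by gcongr; exact (A s - A s₀).le_opNorm x)
    have h2 : κ * (‖A s - A s₀‖ * ‖x‖) ≤ κ * (1 / (2 * κ) * ‖x‖) := by gcongr
    have h3 : (κ : ℝ) * (1 / (2 * κ) * ‖x‖) = ‖x‖ / 2 := by field_simp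
    have h4 := hlow x hx
    have h5 : (κ : ℝ) * ‖A s₀ x‖ ≤ κ * (‖A s x‖ + ‖A s - A s₀‖ * ‖x‖) := by gcongr
    linarith
  have hdisj : Disjoint (LinearMap.ker (A s).toLinearMap) Kᗮ := by
    rw [Submodule.disjoint_def]
    intro x hx hx'
    have h0 : A s x = 0 := hx
    have := hlow' x hx'
    rw [h0, norm_zero, mul_zero] at this
    exact norm_le_zero_iff.1 this
  -- Constant rank enters here: the kernel of `A s` keeps its dimension, so with the fixed space
  -- `Kᗮ` it spans `E`, and the `Kᗮ` component of `δ` is the required correction.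
  have htop := Submodule.eq_top_of_disjoint _ _ (by
    rw [hk s hsI, ← hk s₀ hs₀]
    exact (Submodule.finrank_add_finrank_orthogonal K).ge) hdisj
  intro δ
  obtain ⟨a, ha, c, hc, rfl⟩ := Submodule.mem_sup.1 (htop ▸ Submodule.mem_top : δ ∈ _)
  have ha0 : A s a = 0 := ha
  refine ⟨c, ?_, by simpa using ha0⟩
  rw [map_add, ha0, zero_add]
  exact hlow' c hc

/-- Let `A` be a continuous family of linear maps of constant rank. If the derivative of `A δ` is
given by quadratic forms that vanish on the kernel of `A`, then `A δ` vanishes identically as soon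
as it vanishes at the right end. -/
theorem eqOn_zero_of_quadratic_deriv {m k : ℕ}
    {A : ℝ → E →L[ℝ] (Fin m → ℝ)} {T : Fin m → ℝ → E →L[ℝ] E} {δ : ℝ → E}
    (hA : ContinuousOn A (Icc 0 1)) (hT : ∀ j, ContinuousOn (T j) (Icc 0 1))
    (hδ : ContinuousOn δ (Icc 0 1))
    (hk : ∀ s ∈ Icc (0 : ℝ) 1, Module.finrank ℝ (LinearMap.ker (A s).toLinearMap) = k)
    (hvan : ∀ s ∈ Icc (0 : ℝ) 1, ∀ j, ∀ y, A s y = 0 → inner ℝ y (T j s y) = 0)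
    (hder : ∀ s ∈ Icc (0 : ℝ) 1,
      HasDerivAt (fun s => A s (δ s)) (fun j => inner ℝ (δ s) (T j s (δ s))) s)
    (h1 : A 1 (δ 1) = 0) : ∀ s ∈ Icc (0 : ℝ) 1, A s (δ s) = 0 := by
  obtain ⟨d, hd⟩ := isCompact_Icc.exists_bound_of_continuousOn hδ
  obtain ⟨b, hb⟩ := isCompact_Icc.exists_bound_of_continuousOn (hA.clm_apply hδ)
  choose R hR using fun j => isCompact_Icc.exists_bound_of_continuousOn (hT j)
  set R' := ∑ j, |R j| with hR'
  have hRle : ∀ j, ∀ s ∈ Icc (0 : ℝ) 1, ‖T j s‖ ≤ R' := fun j s hs =>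
    ((hR j s hs).trans (le_abs_self _)).trans
      (Finset.single_le_sum (f := fun j => |R j|) (fun _ _ => abs_nonneg _) (Finset.mem_univ j))
  have hR0 : 0 ≤ R' := Finset.sum_nonneg fun _ _ => abs_nonneg _
  have hd0 : 0 ≤ d := (norm_nonneg _).trans (hd 0 (by simp))
  have hb0 : 0 ≤ b := (norm_nonneg _).trans (hb 0 (by simp))
  -- The quadratic forms vanish at the kernel vector `δ - c`, and what remains is linear in the
  -- small correction `c`, with `‖c‖ ≤ C ‖A δ‖`. Compactness makes the constant uniform.
  have hbound : ∃ K : ℝ, ∀ s ∈ Icc (0 : ℝ) 1,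
      ‖(fun j => inner ℝ (δ s) (T j s (δ s)) : Fin m → ℝ)‖ ≤ K * ‖A s (δ s)‖ := by
    refine isCompact_Icc.induction_on (p := fun U => ∃ K : ℝ, ∀ s ∈ U,
      ‖(fun j => inner ℝ (δ s) (T j s (δ s)) : Fin m → ℝ)‖ ≤ K * ‖A s (δ s)‖) ⟨0, by simp⟩
      (fun U V hUV ⟨K, hK⟩ => ⟨K, fun s hs => hK s (hUV hs)⟩) ?_ ?_
    · rintro U V ⟨K, hK⟩ ⟨K', hK'⟩
      refine ⟨max K K', ?_⟩
      rintro s (hs | hs)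
      · exact (hK s hs).trans (by gcongr; exact le_max_left _ _)
      · exact (hK' s hs).trans (by gcongr; exact le_max_right _ _)
    · intro s₀ hs₀
      obtain ⟨C, hC0, hC⟩ := exists_kernel_approx hA hk hs₀
      refine ⟨_, inter_mem hC self_mem_nhdsWithin, C * (R' * (2 * d + C * b)), ?_⟩
      rintro s ⟨hs, hsI⟩
      obtain ⟨c, hc, hc0⟩ := hs (δ s)
      refine (pi_norm_le_iff_of_nonneg (by positivity)).2 fun j => ?_
      have hsplit : inner ℝ (δ s) (T j s (δ s))
          = inner ℝ c (T j s (δ s)) + inner ℝ (δ s - c) (T j s c) := by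
        have h0 := hvan s hsI j _ hc0
        have : T j s (δ s) = T j s (δ s - c) + T j s c := by rw [← map_add, sub_add_cancel]
        calc inner ℝ (δ s) (T j s (δ s))
            = inner ℝ c (T j s (δ s)) + inner ℝ (δ s - c) (T j s (δ s)) := by
              rw [← inner_add_left]; congr 1; abel
          _ = _ := by rw [this, inner_add_right (δ s - c), h0, zero_add, ← this]
      have hcb : ‖c‖ ≤ C * b := hc.trans (by gcongr; exact hb s hsI)
      have t1 : ‖inner ℝ c (T j s (δ s))‖ ≤ ‖c‖ * (R' * d) := by
        refine (norm_inner_le_norm _ _).trans ?_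
        gcongr
        exact ((T j s).le_opNorm _).trans
          (mul_le_mul (hRle j s hsI) (hd s hsI) (norm_nonneg _) hR0)
      have t2 : ‖inner ℝ (δ s - c) (T j s c)‖ ≤ (d + C * b) * (R' * ‖c‖) := by
        refine (norm_inner_le_norm _ _).trans ?_
        gcongr
        · exact (norm_sub_le _ _).trans (add_le_add (hd s hsI) hcb)
        · exact ((T j s).le_opNorm _).trans (by gcongr; exact hRle j s hsI)
      calc ‖inner ℝ (δ s) (T j s (δ s))‖
          ≤ ‖c‖ * (R' * d) + (d + C * b) * (R' * ‖c‖) := by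
            rw [hsplit]; exact (norm_add_le _ _).trans (add_le_add t1 t2)
        _ = ‖c‖ * (R' * (2 * d + C * b)) := by ring
        _ ≤ C * ‖A s (δ s)‖ * (R' * (2 * d + C * b)) := by gcongr
        _ = _ := by ring
  obtain ⟨K, hK⟩ := hbound
  have hflip : ∀ τ ∈ Icc (0 : ℝ) 1, 1 - τ ∈ Icc (0 : ℝ) 1 := fun τ hτ =>
    ⟨by linarith [hτ.2], by linarith [hτ.1]⟩
  -- Time is reversed, because the vanishing is known at the right end while the Grönwall lemma
  -- starts from the left.
  have hder' : ∀ τ ∈ Icc (0 : ℝ) 1, HasDerivAt (fun τ => A (1 - τ) (δ (1 - τ)))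
      (-fun j => inner ℝ (δ (1 - τ)) (T j (1 - τ) (δ (1 - τ)))) τ := fun τ hτ => by
    have h2 : HasDerivAt (fun τ : ℝ => 1 - τ) (-1) τ := by
      simpa using (hasDerivAt_id τ).const_sub 1
    simpa using! (hder _ (hflip τ hτ)).scomp τ h2
  have := eq_zero_of_abs_deriv_le_mul_abs_self_of_eq_zero_right
    (fun τ hτ => (hder' τ hτ).continuousAt.continuousWithinAt)
    (fun τ hτ => (hder' τ (Ico_subset_Icc_self hτ)).hasDerivWithinAt)
    (by simpa using h1)
    (fun τ hτ => by rw [norm_neg]; exact hK _ (hflip τ (Ico_subset_Icc_self hτ)))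
  intro s hs
  simpa using this (1 - s) (hflip s hs)

end ConstantRank

/-! ### Geodesics whose momentum annihilates the control directions. -/

section ControlDirections

variable {E : Type*} [NormedAddCommGroup E] [InnerProductSpace ℝ E] [FiniteDimensional ℝ E]
  {X : Set E} {G : E → E →L[ℝ] E} {γ : ℝ → E}

/-- Along a geodesic whose final momentum annihilates the control directions, the dual contraction
conditions force the boundary term of the drift to decrease. -/
theorem drift_boundary_le {m k : ℕ} (hX : IsOpen X) (hG : ContDiffOn ℝ 1 G X)
    (hs : ∀ x ∈ X, ∀ v w, inner ℝ (G x v) w = inner ℝ v (G x w))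
    (hγ : ContDiff ℝ ∞ γ) (hγX : MapsTo γ (Icc 0 1) X)
    (hEL : ∀ s ∈ Icc (0 : ℝ) 1, ∀ w : E, inner ℝ (deriv γ s) (fderiv ℝ G (γ s) w (deriv γ s))
      = 2 * inner ℝ (deriv (momentum G γ) s) w)
    {f : E → E} {b : Fin m → E → E} (hf : ContDiffOn ℝ 1 f X) (hb : ∀ j, ContDiffOn ℝ 1 (b j) X)
    (hk : ∀ s ∈ Icc (0 : ℝ) 1, ∃ K : Submodule ℝ E, Module.finrank ℝ K = k ∧
      ∀ y, y ∈ K ↔ ∀ j, inner ℝ (G (γ s) y) (b j (γ s)) = 0)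
    {C : ℝ}
    (hfc : ∀ s ∈ Icc (0 : ℝ) 1, (∀ j, inner ℝ (G (γ s) (deriv γ s)) (b j (γ s)) = 0) →
      inner ℝ (deriv γ s) (fderiv ℝ G (γ s) (f (γ s)) (deriv γ s))
        + 2 * inner ℝ (G (γ s) (deriv γ s)) (fderiv ℝ f (γ s) (deriv γ s)) ≤ C)
    (hbc : ∀ s ∈ Icc (0 : ℝ) 1, ∀ y, (∀ j, inner ℝ (G (γ s) y) (b j (γ s)) = 0) →
      ∀ j, inner ℝ y (fderiv ℝ G (γ s) (b j (γ s)) y)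
        + 2 * inner ℝ (G (γ s) y) (fderiv ℝ (b j) (γ s) y) = 0)
    (h1 : ∀ j, inner ℝ (momentum G γ 1) (b j (γ 1)) = 0) :
    (∀ j, inner ℝ (momentum G γ 0) (b j (γ 0)) = 0) ∧
    2 * inner ℝ (momentum G γ 1) (f (γ 1)) - 2 * inner ℝ (momentum G γ 0) (f (γ 0)) ≤ C := by
  have hdγ : Continuous (deriv γ) := hγ.continuous_deriv (by simp)
  have hγ' : ∀ s, HasDerivAt γ (deriv γ s) s := fun s =>
    (hγ.differentiable (by simp) s).hasDerivAt
  have hGc : ContinuousOn (fun s => G (γ s)) (Icc 0 1) :=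
    hG.continuousOn.comp hγ.continuous.continuousOn hγX
  have hDG : ContinuousOn (fun s => fderiv ℝ G (γ s)) (Icc 0 1) :=
    (hG.continuousOn_fderiv_of_isOpen hX le_rfl).comp hγ.continuous.continuousOn hγX
  have hbcont : ∀ j, ContinuousOn (fun s => b j (γ s)) (Icc 0 1) := fun j =>
    (hb j).continuousOn.comp hγ.continuous.continuousOn hγX
  have hDb : ∀ j, ContinuousOn (fun s => fderiv ℝ (b j) (γ s)) (Icc 0 1) := fun j =>
    ((hb j).continuousOn_fderiv_of_isOpen hX le_rfl).comp hγ.continuous.continuousOn hγX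
  have hchain : ∀ {φ : E → E}, ContDiffOn ℝ 1 φ X → ∀ s ∈ Icc (0 : ℝ) 1,
      HasDerivAt (fun s => φ (γ s)) (fderiv ℝ φ (γ s) (deriv γ s)) s := fun hφ s hs' =>
    (((hφ.contDiffAt (hX.mem_nhds (hγX hs'))).differentiableAt
      one_ne_zero).hasFDerivAt).comp_hasDerivAt s (hγ' s)
  obtain ⟨A, hAapp⟩ : ∃ A : ℝ → E →L[ℝ] (Fin m → ℝ),
      ∀ s y j, A s y j = inner ℝ (G (γ s) y) (b j (γ s)) :=
    ⟨fun s => ContinuousLinearMap.pi fun j => (innerSL ℝ (b j (γ s))).comp (G (γ s)),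
      fun s y j => by simp [real_inner_comm]⟩
  have hA0 : ∀ s y, A s y = 0 ↔ ∀ j, inner ℝ (G (γ s) y) (b j (γ s)) = 0 := fun s y => by
    rw [funext_iff]; simp [hAapp]
  -- By the Euler-Lagrange equation, `T j` gives the derivative of the pairing of momentum with `b
  -- j`; the factor `1 / 2` comes from the 2 in that equation.
  obtain ⟨T, hTdef⟩ : ∃ T : Fin m → ℝ → E →L[ℝ] E, ∀ j s, T j s =
      (1 / 2 : ℝ) • fderiv ℝ G (γ s) (b j (γ s)) + (G (γ s)).comp (fderiv ℝ (b j) (γ s)) :=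
    ⟨_, fun _ _ => rfl⟩
  have hTapp : ∀ j, ∀ s ∈ Icc (0 : ℝ) 1, ∀ y, inner ℝ y (T j s y)
      = (inner ℝ y (fderiv ℝ G (γ s) (b j (γ s)) y)
        + 2 * inner ℝ (G (γ s) y) (fderiv ℝ (b j) (γ s) y)) / 2 := fun j s hs' y => by
    simp only [hTdef, _root_.add_apply, _root_.smul_apply, ContinuousLinearMap.comp_apply,
      inner_add_right, inner_smul_right, hs _ (hγX hs')]
    ring
  have hAc : ContinuousOn A (Icc 0 1) := by
    refine continuousOn_clm_apply.2 fun y => continuousOn_pi.2 fun j => ?_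
    simp only [hAapp]
    exact (hGc.clm_apply continuousOn_const).inner (hbcont j)
  have hTc : ∀ j, ContinuousOn (T j) (Icc 0 1) := fun j => by
    refine continuousOn_clm_apply.2 fun y => ?_
    simp only [hTdef, _root_.add_apply, _root_.smul_apply, ContinuousLinearMap.comp_apply]
    exact (((hDG.clm_apply (hbcont j)).clm_apply continuousOn_const).const_smul (1 / 2 : ℝ)).add
      (hGc.clm_apply ((hDb j).clm_apply continuousOn_const))
  have hker : ∀ s ∈ Icc (0 : ℝ) 1,
      Module.finrank ℝ (LinearMap.ker (A s).toLinearMap) = k := fun s hs' => by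
    obtain ⟨K, hK, hmem⟩ := hk s hs'
    have : LinearMap.ker (A s).toLinearMap = K := by
      ext y
      rw [hmem, ← hA0]
      exact LinearMap.mem_ker
    rw [this, hK]
  have hder : ∀ s ∈ Icc (0 : ℝ) 1, HasDerivAt (fun s => A s (deriv γ s))
      (fun j => inner ℝ (deriv γ s) (T j s (deriv γ s))) s := fun s hs' => by
    refine hasDerivAt_pi.2 fun j => ?_
    have h2 := (hasDerivAt_momentum hX hG hγ (hγX hs')).inner ℝ (hchain (hb j) s hs')
    simp only [hAapp]
    refine h2.congr_deriv ?_
    rw [hTapp j s hs', hEL s hs']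
    simp only [momentum]
    ring
  have hzero := eqOn_zero_of_quadratic_deriv hAc hTc hdγ.continuousOn hker
    (fun s hs' j y hy => by
      rw [hTapp j s hs', hbc s hs' y ((hA0 s y).1 hy) j, zero_div]) hder ((hA0 _ _).2 h1)
  refine ⟨(hA0 _ _).1 (hzero 0 (by simp)), ?_⟩
  exact boundary_le_of_eulerLagrange hX hG hγ hγX hEL (v := fun s => f (γ s)) (hchain hf)
    fun s hs' => hfc s hs' ((hA0 _ _).1 (hzero s hs'))

end ControlDirections

/-! ### Matrices acting on Euclidean space. -/

section Algebra

variable {n m k : ℕ}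

theorem inner_eq_dotProduct (v w : Vec n) : inner ℝ v w = v.ofLp ⬝ᵥ w.ofLp := by
  rw [EuclideanSpace.inner_eq_star_dotProduct, dotProduct_comm]; simp

theorem mulV_mulV (A : Matrix (Fin n) (Fin m) ℝ) (B : Matrix (Fin m) (Fin k) ℝ) (v : Vec k) :
    mulV A (mulV B v) = mulV (A * B) v := by
  simp [mulV, Matrix.mulVec_mulVec]

theorem add_mulV (A B : Matrix (Fin n) (Fin m) ℝ) (v : Vec m) :
    mulV (A + B) v = mulV A v + mulV B v := by
  simp [mulV, Matrix.add_mulVec]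

theorem sub_mulV (A B : Matrix (Fin n) (Fin m) ℝ) (v : Vec m) :
    mulV (A - B) v = mulV A v - mulV B v := by
  simp [mulV, Matrix.sub_mulVec]

theorem neg_mulV (A : Matrix (Fin n) (Fin m) ℝ) (v : Vec m) : mulV (-A) v = -mulV A v := by
  simp [mulV, Matrix.neg_mulVec]

theorem smul_mulV (c : ℝ) (A : Matrix (Fin n) (Fin m) ℝ) (v : Vec m) :
    mulV (c • A) v = c • mulV A v := by
  simp [mulV, Matrix.smul_mulVec]

theorem mulV_add (A : Matrix (Fin n) (Fin m) ℝ) (v w : Vec m) :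
    mulV A (v + w) = mulV A v + mulV A w := by
  simp [mulV, Matrix.mulVec_add]

theorem sum_mulV {ι : Type*} (s : Finset ι) (A : ι → Matrix (Fin n) (Fin m) ℝ) (v : Vec m) :
    mulV (∑ i ∈ s, A i) v = ∑ i ∈ s, mulV (A i) v := by
  classical
  induction s using Finset.induction_on with
  | empty => simp [mulV]
  | insert i s hi ih => rw [Finset.sum_insert hi, Finset.sum_insert hi, add_mulV, ih]

theorem inner_mulV_left (A : Matrix (Fin n) (Fin m) ℝ) (v : Vec m) (w : Vec n) :
    inner ℝ (mulV A v) w = inner ℝ v (mulV Aᵀ w) := by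
  rw [inner_eq_dotProduct, inner_eq_dotProduct]
  simp [mulV, Matrix.mulVec_transpose, Matrix.dotProduct_mulVec, dotProduct_comm]

theorem inner_symmz (Q : Matrix (Fin n) (Fin n) ℝ) (v : Vec n) :
    inner ℝ v (mulV (symmz Q) v) = 2 * inner ℝ v (mulV Q v) := by
  rw [symmz, add_mulV, inner_add_right, ← inner_mulV_left, real_inner_comm]
  ring

theorem inner_mulV_self_nonneg {Q : Matrix (Fin n) (Fin n) ℝ} (hQ : Q.PosSemidef) (v : Vec n) :
    0 ≤ inner ℝ v (mulV Q v) := by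
  rw [inner_eq_dotProduct]
  simpa [mulV] using hQ.dotProduct_mulVec_nonneg v.ofLp

theorem mulV_eq_sum_col (B : Vec n → Matrix (Fin n) (Fin m) ℝ) (x : Vec n) (u : Vec m) :
    mulV (B x) u = ∑ j, u j • col B j x := by
  ext i
  simp [mulV, col, Matrix.mulVec, dotProduct, mul_comm]

theorem mulV_transpose_apply (B : Vec n → Matrix (Fin n) (Fin m) ℝ) (x : Vec n) (w : Vec n)
    (j : Fin m) : (mulV (B x)ᵀ w) j = inner ℝ w (col B j x) := by
  rw [inner_eq_dotProduct]
  simp [mulV, col, Matrix.mulVec, dotProduct, mul_comm]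

theorem mulV_jac (φ : Vec n → Vec m) (x v : Vec n) :
    mulV (jac φ x) v = fderiv ℝ φ x v := by
  have hv : v = ∑ j, v j • EuclideanSpace.single j (1 : ℝ) := by
    ext i; simp [Pi.single_apply]
  conv_rhs => rw [hv]
  ext i
  simp [mulV, jac, Matrix.mulVec, dotProduct, mul_comm]

end Algebra

/-! ### Rayleigh bounds. -/

section Eigenvalues

variable {n : ℕ} {Q : Matrix (Fin n) (Fin n) ℝ}

/-- Subtracting the least eigenvalue shifts the spectrum into `[0, ∞)`, which for a Hermitian matrix
means positive semidefinite. -/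
theorem minEig_mul_le (hQ : Q.IsHermitian) (v : Vec n) :
    minEig Q * ‖v‖ ^ 2 ≤ inner ℝ v (mulV Q v) := by
  have hfin : (spectrum ℝ Q).Finite := by
    rw [hQ.spectrum_real_eq_range_eigenvalues]; exact finite_range _
  have hps : (Q - algebraMap ℝ (Matrix (Fin n) (Fin n) ℝ) (minEig Q)).PosSemidef := by
    refine Matrix.posSemidef_iff_isHermitian_and_spectrum_nonneg.2 ⟨?_, ?_⟩
    · refine hQ.sub ?_
      simp [Matrix.IsHermitian, Matrix.algebraMap_eq_diagonal]
    · rw [← spectrum.sub_singleton_eq]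
      rintro _ ⟨a, ha, _, rfl, rfl⟩
      exact sub_nonneg.2 (csInf_le hfin.bddBelow ha)
  have := inner_mulV_self_nonneg hps v
  rw [sub_mulV, inner_sub_right, Algebra.algebraMap_eq_smul_one, smul_mulV, inner_smul_right] at this
  have h1 : mulV (1 : Matrix (Fin n) (Fin n) ℝ) v = v := by simp [mulV]
  rw [h1, real_inner_self_eq_norm_sq] at this
  linarith

theorem le_maxEig_mul (hQ : Q.IsHermitian) (v : Vec n) :
    inner ℝ v (mulV Q v) ≤ maxEig Q * ‖v‖ ^ 2 := by
  have hfin : (spectrum ℝ Q).Finite := by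
    rw [hQ.spectrum_real_eq_range_eigenvalues]; exact finite_range _
  have hps : (algebraMap ℝ (Matrix (Fin n) (Fin n) ℝ) (maxEig Q) - Q).PosSemidef := by
    refine Matrix.posSemidef_iff_isHermitian_and_spectrum_nonneg.2 ⟨?_, ?_⟩
    · refine Matrix.IsHermitian.sub ?_ hQ
      simp [Matrix.IsHermitian, Matrix.algebraMap_eq_diagonal]
    · rw [← spectrum.singleton_sub_eq]
      rintro _ ⟨_, rfl, a, ha, rfl⟩
      exact sub_nonneg.2 (le_csSup hfin.bddAbove ha)
  have := inner_mulV_self_nonneg hps v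
  rw [sub_mulV, inner_sub_right, Algebra.algebraMap_eq_smul_one, smul_mulV, inner_smul_right] at this
  have h1 : mulV (1 : Matrix (Fin n) (Fin n) ℝ) v = v := by simp [mulV]
  rw [h1, real_inner_self_eq_norm_sq] at this
  linarith

end Eigenvalues

/-! ### Derivatives of matrix fields and of the dual metric. -/

section MatrixFields

variable {n m : ℕ}

/-- The field of operators on Euclidean space given by a field of matrices. -/
def opField (Q : Vec n → Matrix (Fin n) (Fin n) ℝ) (x : Vec n) : Vec n →L[ℝ] Vec n :=
  Matrix.toEuclideanCLM (𝕜 := ℝ) (Q x)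

theorem opField_apply (Q : Vec n → Matrix (Fin n) (Fin n) ℝ) (x v : Vec n) :
    opField Q x v = mulV (Q x) v := rfl

/-- The operator of a matrix, as a continuous linear function of the entries. -/
def entriesToOp (n : ℕ) : (Fin n → Fin n → ℝ) →L[ℝ] (Vec n →L[ℝ] Vec n) :=
  LinearMap.toContinuousLinearMap
    { toFun := fun A => Matrix.toEuclideanCLM (𝕜 := ℝ) (Matrix.of A)
      map_add' := fun A B => map_add (Matrix.toEuclideanCLM (n := Fin n) (𝕜 := ℝ))
        (Matrix.of A) (Matrix.of B)
      map_smul' := fun c A => map_smul (Matrix.toEuclideanCLM (n := Fin n) (𝕜 := ℝ)) c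
        (Matrix.of A) }

theorem opField_eq_entriesToOp (Q : Vec n → Matrix (Fin n) (Fin n) ℝ) :
    opField Q = fun x => entriesToOp n fun i j => Q x i j := rfl

theorem contDiffOn_opField {X : Set (Vec n)} {Q : Vec n → Matrix (Fin n) (Fin n) ℝ}
    (hQ : ∀ i j, ContDiffOn ℝ 1 (fun x => Q x i j) X) : ContDiffOn ℝ 1 (opField Q) X := by
  rw [opField_eq_entriesToOp]
  exact (entriesToOp n).contDiff.comp_contDiffOn
    (contDiffOn_pi.2 fun i => contDiffOn_pi.2 fun j => hQ i j)

theorem fderiv_opField_apply {Q : Vec n → Matrix (Fin n) (Fin n) ℝ} {x : Vec n}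
    (hQ : ∀ i j, DifferentiableAt ℝ (fun x => Q x i j) x) (y v : Vec n) :
    fderiv ℝ (opField Q) x y v = mulV (dirDeriv Q y x) v := by
  have h1 : HasFDerivAt (fun (x : Vec n) (i j : Fin n) => Q x i j)
      (ContinuousLinearMap.pi fun i => ContinuousLinearMap.pi fun j =>
        fderiv ℝ (fun z => Q z i j) x) x :=
    hasFDerivAt_pi.2 fun i => hasFDerivAt_pi.2 fun j => (hQ i j).hasFDerivAt
  have h2 := ((entriesToOp n).hasFDerivAt.comp x h1).fderiv
  have h3 : opField Q = entriesToOp n ∘ fun (x : Vec n) (i j : Fin n) => Q x i j := rfl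
  rw [h3, h2]
  rfl

theorem opField_symmetric {Q : Vec n → Matrix (Fin n) (Fin n) ℝ} {x : Vec n}
    (hQ : (Q x).IsHermitian) (v w : Vec n) :
    inner ℝ (opField Q x v) w = inner ℝ v (opField Q x w) := by
  have : (Q x)ᵀ = Q x := by simpa [Matrix.IsHermitian] using hQ
  rw [opField_apply, opField_apply, inner_mulV_left, this]

theorem hasFDerivAt_opField_inv {X : Set (Vec n)} (hX : IsOpen X)
    {M : Vec n → Matrix (Fin n) (Fin n) ℝ} (hM : ∀ i j, ContDiffOn ℝ 1 (fun x => M x i j) X)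
    (hpos : ∀ x ∈ X, (M x).PosDef) {x : Vec n} (hx : x ∈ X) :
    ∃ D : Vec n →L[ℝ] Vec n →L[ℝ] Vec n, HasFDerivAt (opField fun x => (M x)⁻¹) D x ∧
      ∀ y v, D y v = -mulV (M x)⁻¹ (fderiv ℝ (opField M) x y (mulV (M x)⁻¹ v)) := by
  have hunit : ∀ z ∈ X, (opField fun x => (M x)⁻¹) z * opField M z = 1 ∧
      opField M z * (opField fun x => (M x)⁻¹) z = 1 := fun z hz => by
    have hdet : IsUnit (M z).det := (Matrix.isUnit_iff_isUnit_det _).1 (hpos z hz).isUnit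
    constructor
    · rw [opField, opField, ← map_mul, Matrix.nonsing_inv_mul _ hdet, map_one]
    · rw [opField, opField, ← map_mul, Matrix.mul_nonsing_inv _ hdet, map_one]
  let U : ∀ z ∈ X, (Vec n →L[ℝ] Vec n)ˣ := fun z hz =>
    ⟨opField M z, (opField fun x => (M x)⁻¹) z, (hunit z hz).2, (hunit z hz).1⟩
  -- On `X` the matrix inverse is inversion in the operator algebra, whose derivative at `M` is
  -- `-M⁻¹ (·) M⁻¹`.
  have hinv : ∀ z ∈ X, (opField fun x => (M x)⁻¹) z = Ring.inverse (opField M z) := fun z hz =>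
    (Ring.inverse_unit (U z hz)).symm
  have hG : HasFDerivAt (opField M) (fderiv ℝ (opField M) x) x :=
    (((contDiffOn_opField hM).contDiffAt (hX.mem_nhds hx)).differentiableAt
      one_ne_zero).hasFDerivAt
  have hR := (hasFDerivAt_ringInverse (𝕜 := ℝ) (U x hx)).comp x hG
  refine ⟨_, hR.congr_of_eventuallyEq ?_, fun y v => ?_⟩
  · filter_upwards [hX.mem_nhds hx] with z hz using hinv z hz
  · rfl

/-- The derivative of the dual metric `M⁻¹`, evaluated on a covector `M y`. -/
theorem inner_dirDeriv_inv {X : Set (Vec n)} (hX : IsOpen X)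
    {M : Vec n → Matrix (Fin n) (Fin n) ℝ} (hM : ∀ i j, ContDiffOn ℝ 1 (fun x => M x i j) X)
    (hpos : ∀ x ∈ X, (M x).PosDef) {x : Vec n} (hx : x ∈ X) (w y : Vec n) :
    inner ℝ (mulV (M x) y) (mulV (dirDeriv (fun x => (M x)⁻¹) w x) (mulV (M x) y))
      = -inner ℝ y (fderiv ℝ (opField M) x w y) := by
  obtain ⟨D, hD, hDv⟩ := hasFDerivAt_opField_inv hX hM hpos hx
  have hdet : IsUnit (M x).det := (Matrix.isUnit_iff_isUnit_det _).1 (hpos x hx).isUnit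
  have hent : ∀ i j, DifferentiableAt ℝ (fun x => (M x)⁻¹ i j) x := fun i j => by
    have h1 : (fun x => (M x)⁻¹ i j) = fun x =>
        ((opField fun x => (M x)⁻¹) x (EuclideanSpace.single j 1)) i := by
      funext z; simp [opField_apply, mulV]
    rw [h1]
    have h2 := hD.differentiableAt.clm_apply
      (differentiableAt_const (EuclideanSpace.single j (1 : ℝ)))
    exact (EuclideanSpace.proj (𝕜 := ℝ) i).differentiableAt.comp x h2
  have hone : ∀ v : Vec n, mulV (1 : Matrix (Fin n) (Fin n) ℝ) v = v := fun v => by simp [mulV]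
  rw [← fderiv_opField_apply hent, hD.fderiv, hDv, inner_neg_right, ← opField_apply M,
    opField_symmetric (hpos x hx).isHermitian, opField_apply, opField_apply, mulV_mulV, mulV_mulV,
    Matrix.nonsing_inv_mul _ hdet, Matrix.mul_nonsing_inv _ hdet, hone, hone]

theorem contDiffOn_col {X : Set (Vec n)} {B : Vec n → Matrix (Fin n) (Fin m) ℝ}
    (hB : ∀ i j, ContDiffOn ℝ 1 (fun x => B x i j) X) (j : Fin m) :
    ContDiffOn ℝ 1 (col B j) X :=
  contDiffOn_euclidean.2 fun i => hB i j

end MatrixFields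

/-! ### The contraction conditions as inequalities on tangent vectors. -/

section Conditions

variable {n m k : ℕ} {X : Set (Vec n)} {f : Vec n → Vec n} {B : Vec n → Matrix (Fin n) (Fin m) ℝ}
  {M : Vec n → Matrix (Fin n) (Fin n) ℝ} {lam : ℝ}

theorem metricInner_eq (M : Vec n → Matrix (Fin n) (Fin n) ℝ) (x v w : Vec n) :
    metricInner M x v w = inner ℝ v (opField M x w) := rfl

/-- The quadratic form of `weakLHS` in terms of derivatives of the vector fields. -/
theorem inner_weakLHS {κ : Vec n → Vec n → Vec m → Vec m} {xt xs : Vec n} {us : Vec m}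
    (hM : ∀ i j, DifferentiableAt ℝ (fun x => M x i j) (xs + xt))
    (hpos : (M (xs + xt)).PosDef) (y : Vec n) :
    inner ℝ y (mulV (weakLHS f B M lam κ xt xs us) y) =
      inner ℝ y (fderiv ℝ (opField M) (xs + xt) (affineModel f B (xs + xt) (κ xt xs us)) y)
      + 2 * inner ℝ (opField M (xs + xt) y) (fderiv ℝ f (xs + xt) y
        + ∑ j, κ xt xs us j • fderiv ℝ (col B j) (xs + xt) y
        + mulV (B (xs + xt)) (fderiv ℝ (fun y => κ y xs us) xt y))
      + 2 * lam * inner ℝ y (opField M (xs + xt) y) := by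
  simp only [weakLHS]
  rw [add_mulV, add_mulV, inner_add_right, inner_add_right, inner_symmz, smul_mulV,
    inner_smul_right, ← fderiv_opField_apply hM, ← mulV_mulV, ← opField_apply M,
    ← opField_apply M, ← opField_symmetric hpos.isHermitian, add_mulV, add_mulV, sum_mulV,
    ← mulV_mulV, mulV_jac, mulV_jac]
  simp only [smul_mulV, mulV_jac]

/-- The strong conditions, expressed on tangent vectors whose momentum annihilates the control
directions. -/
theorem StrongConditions.tangent {Bp : Vec n → Matrix (Fin n) (Fin k) ℝ} {S : Set (Vec n)}
    (hstrong : StrongConditions f B M lam S Bp) (hX : IsOpen X) (hSX : S ⊆ X)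
    (hM : ∀ i j, ContDiffOn ℝ 1 (fun x => M x i j) X) (hpos : ∀ x ∈ X, (M x).PosDef)
    {x : Vec n} (hx : x ∈ S) {y : Vec n}
    (hy : ∀ j, inner ℝ (opField M x y) (col B j x) = 0) :
    inner ℝ y (fderiv ℝ (opField M) x (f x) y)
        + 2 * inner ℝ (opField M x y) (fderiv ℝ f x y)
        + 2 * lam * inner ℝ y (opField M x y) ≤ 0 ∧
    ∀ j, inner ℝ y (fderiv ℝ (opField M) x (col B j x) y)
        + 2 * inner ℝ (opField M x y) (fderiv ℝ (col B j) x y) = 0 := by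
  obtain ⟨⟨-, hspan⟩, hdrift, hkill⟩ := hstrong x hx
  have hxX := hSX hx
  have hdet : IsUnit (M x).det := (Matrix.isUnit_iff_isUnit_det _).1 (hpos x hxX).isUnit
  have hW : mulV (M x)⁻¹ (mulV (M x) y) = y := by
    rw [mulV_mulV, Matrix.nonsing_inv_mul _ hdet]; simp [mulV]
  -- The momentum `M y` lies in the null space of `Bᵀ`, so it equals `B_⊥ z` and the dual conditions
  -- can be tested on `z`.
  obtain ⟨z, hz⟩ : ∃ z : Vec k, mulV (Bp x) z = mulV (M x) y := by
    have hmem : (mulV (M x) y).ofLp ∈ LinearMap.ker (B x)ᵀ.mulVecLin := by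
      rw [LinearMap.mem_ker]
      funext j
      exact (mulV_transpose_apply B x (mulV (M x) y) j).trans (hy j)
    rw [← hspan, Submodule.mem_span_range_iff_exists_fun] at hmem
    obtain ⟨c, hc⟩ := hmem
    refine ⟨WithLp.toLp 2 c, ?_⟩
    ext i
    have := congrFun hc i
    simp only [Finset.sum_apply, Pi.smul_apply, Matrix.transpose_apply, smul_eq_mul] at this
    rw [← this]
    simp [mulV, Matrix.mulVec, dotProduct, mul_comm]
  have hconj : ∀ Q : Matrix (Fin n) (Fin n) ℝ,
      inner ℝ z (mulV ((Bp x)ᵀ * Q * Bp x) z)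
        = inner ℝ (mulV (M x) y) (mulV Q (mulV (M x) y)) := fun Q => by
    rw [← mulV_mulV, ← mulV_mulV, ← inner_mulV_left, hz]
  have hsym : inner ℝ (mulV (M x) y) y = inner ℝ y (opField M x y) := by
    rw [← opField_symmetric (hpos x hxX).isHermitian]; rfl
  constructor
  · have h0 := inner_mulV_self_nonneg hdrift z
    rw [neg_mulV, inner_neg_right, hconj, add_mulV, add_mulV, neg_mulV, inner_add_right,
      inner_add_right, inner_neg_right, inner_dirDeriv_inv hX hM hpos hxX, inner_symmz, smul_mulV,
      inner_smul_right, ← mulV_mulV, hW, mulV_jac, hsym] at h0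
    rw [opField_apply M x y] at h0 ⊢
    linarith
  · intro j
    have h0 := hconj (dirDeriv (fun x => (M x)⁻¹) (col B j x) x - symmz (jac (col B j) x * (M x)⁻¹))
    rw [hkill j, sub_mulV, inner_sub_right, inner_dirDeriv_inv hX hM hpos hxX, inner_symmz,
      ← mulV_mulV, hW, mulV_jac] at h0
    have hz0 : mulV (0 : Matrix (Fin k) (Fin k) ℝ) z = 0 := by simp [mulV]
    rw [hz0, inner_zero_right] at h0
    rw [opField_apply M x y]
    linarith

/-- The tangent vectors whose momentum annihilates the control directions form a subspace of
dimension `k`. -/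
theorem IsNullBasis.exists_tangent_subspace {x : Vec n} {P : Matrix (Fin n) (Fin k) ℝ}
    (hP : IsNullBasis (B x)ᵀ P) (hpos : (M x).PosDef) :
    ∃ K : Submodule ℝ (Vec n), Module.finrank ℝ K = k ∧
      ∀ y, y ∈ K ↔ ∀ j, inner ℝ (opField M x y) (col B j x) = 0 := by
  obtain ⟨hli, hspan⟩ := hP
  have hdet : IsUnit (M x).det := (Matrix.isUnit_iff_isUnit_det _).1 hpos.isUnit
  let e₀ : (Fin n → ℝ) ≃ₗ[ℝ] (Fin n → ℝ) :=
    -- The map `y ↦ M y` is an isomorphism, so the preimage of the null space of `Bᵀ` has the same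
    -- dimension `k`.
    LinearEquiv.ofLinearMap (M x).mulVecLin (M x)⁻¹.mulVecLin
      (by rw [← Matrix.mulVecLin_mul, Matrix.mul_nonsing_inv _ hdet, Matrix.mulVecLin_one])
      (by rw [← Matrix.mulVecLin_mul, Matrix.nonsing_inv_mul _ hdet, Matrix.mulVecLin_one])
  let e : Vec n ≃ₗ[ℝ] (Fin n → ℝ) := (WithLp.linearEquiv 2 ℝ (Fin n → ℝ)).trans e₀
  refine ⟨(LinearMap.ker (B x)ᵀ.mulVecLin).map e.symm.toLinearMap, ?_, fun y => ?_⟩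
  · rw [LinearEquiv.finrank_map_eq, ← hspan, finrank_span_eq_card hli, Fintype.card_fin]
  · rw [Submodule.mem_map_equiv, LinearEquiv.symm_symm, LinearMap.mem_ker, funext_iff]
    refine forall_congr' fun j => ?_
    rw [opField_apply, ← mulV_transpose_apply]
    rfl

end Conditions

/-! ### Riemannian distance versus curve energy. -/

section Energy

variable {n : ℕ} {X : Set (Vec n)} {M : Vec n → Matrix (Fin n) (Fin n) ℝ}

theorem curveLength_nonneg (M : Vec n → Matrix (Fin n) (Fin n) ℝ) (c : ℝ → Vec n) :
    0 ≤ curveLength M c :=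
  intervalIntegral.integral_nonneg zero_le_one fun _ _ => Real.sqrt_nonneg _

theorem riemDist_nonneg (X : Set (Vec n)) (M : Vec n → Matrix (Fin n) (Fin n) ℝ) (p q : Vec n) :
    0 ≤ riemDist X M p q :=
  Real.sInf_nonneg (by rintro _ ⟨c, -, rfl⟩; exact curveLength_nonneg M c)

/-- Squared length is at most energy, by Cauchy-Schwarz. This replaces the distance by a functional
that is differentiable under variations. -/
theorem riemEnergy_le_curveEnergy
    (hM : ∀ i j, ContDiffOn ℝ 1 (fun x => M x i j) X) (hpos : ∀ x ∈ X, (M x).PosDef)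
    {c : ℝ → Vec n} (hc : ContDiff ℝ ∞ c) (hcX : MapsTo c (Icc 0 1) X) :
    riemEnergy X M (c 0) (c 1) ≤ curveEnergy (opField M) c := by
  have h1 : riemDist X M (c 0) (c 1) ≤ curveLength M c :=
    csInf_le ⟨0, by rintro _ ⟨c, -, rfl⟩; exact curveLength_nonneg M c⟩
      ⟨c, ⟨hc, rfl, rfl, hcX⟩, rfl⟩
  have hdc : Continuous (deriv c) := hc.continuous_deriv (by simp)
  have hG : ContinuousOn (fun s => opField M (c s)) (Icc 0 1) :=
    (contDiffOn_opField hM).continuousOn.comp hc.continuous.continuousOn hcX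
  have hcont : ContinuousOn (fun s => metricInner M (c s) (deriv c s) (deriv c s)) (Icc 0 1) :=
    hdc.continuousOn.inner (hG.clm_apply hdc.continuousOn)
  calc riemEnergy X M (c 0) (c 1) ≤ curveLength M c ^ 2 :=
        pow_le_pow_left₀ (riemDist_nonneg _ _ _ _) h1 2
    _ ≤ ∫ s in (0 : ℝ)..1, Real.sqrt (metricInner M (c s) (deriv c s) (deriv c s)) ^ 2 :=
        sq_integral_le_integral_sq hcont.sqrt
    _ = curveEnergy (opField M) c := by
        refine intervalIntegral.integral_congr fun s hs => ?_
        rw [uIcc_of_le zero_le_one] at hs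
        exact Real.sq_sqrt (inner_mulV_self_nonneg (hpos _ (hcX hs)).posSemidef _)

theorem IsMinGeodesic.inner_deriv (hpos : ∀ x ∈ X, (M x).PosDef) {p q : Vec n} {c : ℝ → Vec n}
    (hc : IsMinGeodesic X M p q c) {s : ℝ} (hs : s ∈ Icc (0 : ℝ) 1) :
    inner ℝ (deriv c s) (opField M (c s) (deriv c s)) = riemEnergy X M p q := by
  rw [riemEnergy, ← hc.2 s hs, metricInner_eq, Real.sq_sqrt]
  exact inner_mulV_self_nonneg (hpos _ (hc.1.2.2.2 hs)).posSemidef _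

theorem IsMinGeodesic.curveEnergy_eq (hpos : ∀ x ∈ X, (M x).PosDef) {p q : Vec n} {c : ℝ → Vec n}
    (hc : IsMinGeodesic X M p q c) : curveEnergy (opField M) c = riemEnergy X M p q := by
  have : curveEnergy (opField M) c = ∫ _ in (0 : ℝ)..1, riemEnergy X M p q := by
    refine intervalIntegral.integral_congr fun s hs => ?_
    rw [uIcc_of_le zero_le_one] at hs
    exact hc.inner_deriv hpos hs
  simpa using this

/-- A minimizing geodesic satisfies the Euler-Lagrange equation. -/
theorem IsMinGeodesic.eulerLagrange (hX : IsOpen X)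
    (hM : ∀ i j, ContDiffOn ℝ 1 (fun x => M x i j) X) (hpos : ∀ x ∈ X, (M x).PosDef)
    {p q : Vec n} {c : ℝ → Vec n} (hc : IsMinGeodesic X M p q c) :
    ∀ s ∈ Icc (0 : ℝ) 1, ∀ w, inner ℝ (deriv c s) (fderiv ℝ (opField M) (c s) w (deriv c s))
      = 2 * inner ℝ (deriv (momentum (opField M) c) s) w := by
  obtain ⟨hsm, h0, h1, hcX⟩ := hc.1
  refine eulerLagrange_of_firstVariation_eq_zero hX (contDiffOn_opField hM) hsm hcX
    fun v hv hv0 hv1 => firstVariation_eq_zero_of_minimizing hX (contDiffOn_opField hM)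
      (fun x hx => opField_symmetric (hpos x hx).isHermitian) hsm hcX ?_ hv hv0 hv1
  intro c' hc' h0' h1' hcX'
  -- Constant speed makes the energy of the geodesic equal to the squared distance, so a length
  -- minimizer also minimizes energy.
  rw [hc.curveEnergy_eq hpos, ← h0, ← h1, ← h0', ← h1']
  exact riemEnergy_le_curveEnergy hM hpos hc' hcX'

end Energy

/-! ### Both controllers satisfy the boundary inequality. -/

section Controllers

variable {n m k : ℕ} {X : Set (Vec n)} {f : Vec n → Vec n} {B : Vec n → Matrix (Fin n) (Fin m) ℝ}
  {M : Vec n → Matrix (Fin n) (Fin n) ℝ} {lam : ℝ}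

/-- The first variation formula along the closed loop of a contracting feedback law. -/
theorem IsWeakContracting.boundary_le {D : Set (Pair n m)} {εmax : ℝ}
    {κ : Vec n → Vec n → Vec m → Vec m} (hκ : IsWeakContracting f B M lam D εmax κ)
    (hX : IsOpen X) (hf : ContDiffOn ℝ 1 f X)
    (hB : ∀ i j, ContDiffOn ℝ 1 (fun x => B x i j) X)
    (hM : ∀ i j, ContDiffOn ℝ 1 (fun x => M x i j) X) (hpos : ∀ x ∈ X, (M x).PosDef)
    {xs x : Vec n} {us : Vec m} (hnom : pair xs us ∈ D) {c : ℝ → Vec n}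
    (hc : IsMinGeodesic X M xs x c) (hcD : MapsTo c (Icc 0 1) (stateProj D))
    (hε : ∀ s ∈ Icc (0 : ℝ) 1, ‖c s - xs‖ < εmax) :
    2 * inner ℝ (momentum (opField M) c 1) (affineModel f B x (κ (x - xs) xs us))
      - 2 * inner ℝ (momentum (opField M) c 0) (affineModel f B xs us)
      ≤ -2 * lam * riemEnergy X M xs x := by
  obtain ⟨hsm, h0, h1, hcX⟩ := hc.1
  obtain ⟨hκ0, hκ1⟩ := hκ xs us hnom
  have hc' : ∀ s, HasDerivAt c (deriv c s) s := fun s =>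
    (hsm.differentiable (by simp) s).hasDerivAt
  have hdiff : ∀ {φ : Vec n → Vec n}, ContDiffOn ℝ 1 φ X → ∀ s ∈ Icc (0 : ℝ) 1,
      HasDerivAt (fun s => φ (c s)) (fderiv ℝ φ (c s) (deriv c s)) s := fun hφ s hs =>
    (((hφ.contDiffAt (hX.mem_nhds (hcX hs))).differentiableAt
      one_ne_zero).hasFDerivAt).comp_hasDerivAt s (hc' s)
  have hback : ∀ s, xs + (c s - xs) = c s := fun s => by abel
  have hk : ∀ s ∈ Icc (0 : ℝ) 1, HasDerivAt (fun s => κ (c s - xs) xs us)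
      (fderiv ℝ (fun y => κ y xs us) (c s - xs) (deriv c s)) s := fun s hs => by
    have hκd : HasFDerivAt (fun y => κ y xs us) (fderiv ℝ (fun y => κ y xs us) (c s - xs))
        (c s - xs) := (hκ1 _ (hε s hs) (by rw [hback]; exact hcD hs)).1.hasFDerivAt
    exact hκd.comp_hasDerivAt s ((hc' s).sub_const xs)
  have hkj : ∀ s ∈ Icc (0 : ℝ) 1, ∀ j, HasDerivAt (fun s => κ (c s - xs) xs us j)
      (fderiv ℝ (fun y => κ y xs us) (c s - xs) (deriv c s) j) s := fun s hs j =>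
    (EuclideanSpace.proj (𝕜 := ℝ) j).hasFDerivAt.comp_hasDerivAt s (hk s hs)
  -- The closed-loop field along the geodesic, with `xs` and `us` frozen. It equals the nominal
  -- velocity at `s = 0`, since `κ` vanishes in deviation to `us`, and the executed model velocity
  -- at `s = 1`.
  have hv : ∀ s ∈ Icc (0 : ℝ) 1,
      HasDerivAt (fun s => affineModel f B (c s) (κ (c s - xs) xs us))
        (fderiv ℝ f (c s) (deriv c s)
          + ∑ j, κ (c s - xs) xs us j • fderiv ℝ (col B j) (c s) (deriv c s)
          + mulV (B (c s)) (fderiv ℝ (fun y => κ y xs us) (c s - xs) (deriv c s))) s :=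
    fun s hs => by
      have hsum := HasDerivAt.fun_sum (u := Finset.univ) fun j _ =>
        (hkj s hs j).smul (hdiff (contDiffOn_col hB j) s hs)
      have := (hdiff hf s hs).add hsum
      simp only [affineModel, mulV_eq_sum_col B]
      refine this.congr_deriv ?_
      rw [Finset.sum_add_distrib, add_assoc]
  have key := boundary_le_of_eulerLagrange hX (contDiffOn_opField hM) hsm hcX
    (hc.eulerLagrange hX hM hpos) hv (C := -2 * lam * riemEnergy X M xs x) fun s hs => by
      have hneg := inner_mulV_self_nonneg
        (hκ1 _ (hε s hs) (by rw [hback]; exact hcD hs)).2.posSemidef (deriv c s)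
      have hMd : ∀ i j, DifferentiableAt ℝ (fun x => M x i j) (xs + (c s - xs)) := fun i j => by
        rw [hback]
        exact ((hM i j).contDiffAt (hX.mem_nhds (hcX hs))).differentiableAt one_ne_zero
      rw [neg_mulV, inner_neg_right, inner_weakLHS hMd (by rw [hback]; exact hpos _ (hcX hs))]
        at hneg
      simp only [hback, hc.inner_deriv hpos hs] at hneg
      simp only [momentum]
      linarith
  simpa only [h0, h1, sub_self, hκ0] using key

/-- The first variation formula under the optimization-based controller. In particular the
optimization problem is feasible under the strong conditions. -/
theorem IsMinNormFeedback.boundary_le {S : Set (Vec n)} {Bp : Vec n → Matrix (Fin n) (Fin k) ℝ}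
    (hstrong : StrongConditions f B M lam S Bp)
    (hX : IsOpen X) (hSX : S ⊆ X) (hf : ContDiffOn ℝ 1 f X)
    (hB : ∀ i j, ContDiffOn ℝ 1 (fun x => B x i j) X)
    (hM : ∀ i j, ContDiffOn ℝ 1 (fun x => M x i j) X) (hpos : ∀ x ∈ X, (M x).PosDef)
    {xs x : Vec n} {us u : Vec m} {c : ℝ → Vec n}
    (hc : IsMinGeodesic X M xs x c) (hcS : MapsTo c (Icc 0 1) S)
    (hu : IsMinNormFeedback f B M lam X xs x us c (u - us)) :
    2 * inner ℝ (momentum (opField M) c 1) (affineModel f B x u)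
      - 2 * inner ℝ (momentum (opField M) c 0) (affineModel f B xs us)
      ≤ -2 * lam * riemEnergy X M xs x := by
  obtain ⟨hsm, h0, h1, hcX⟩ := hc.1
  have hsymm : ∀ x ∈ X, ∀ v w, inner ℝ (opField M x v) w = inner ℝ v (opField M x w) :=
    fun x hx => opField_symmetric (hpos x hx).isHermitian
  have hm1 : ∀ w, metricInner M x (deriv c 1) w = inner ℝ (momentum (opField M) c 1) w :=
    fun w => by
      rw [momentum, hsymm _ (hcX (by simp)), h1]; rfl
  have hm0 : ∀ w, metricInner M xs (deriv c 0) w = inner ℝ (momentum (opField M) c 0) w :=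
    fun w => by
      rw [momentum, hsymm _ (hcX (by simp)), h0]; rfl
  have hfeas : (feasibleFeedback f B M lam X xs x us c).Nonempty := by
    -- The constraint is affine in `v`, with linear part given by the pairings of the final momentum
    -- with the columns of `B`. When all of these vanish, `v = 0` must already be feasible.
    by_cases hz : ∀ j, inner ℝ (momentum (opField M) c 1) (col B j x) = 0
    · obtain ⟨hz0, hle⟩ := drift_boundary_le hX (contDiffOn_opField hM) hsymm hsm hcX
        (hc.eulerLagrange hX hM hpos) hf (contDiffOn_col hB)
        (fun s hs => (hstrong _ (hcS hs)).1.exists_tangent_subspace (hpos _ (hcX hs)))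
        (C := -2 * lam * riemEnergy X M xs x)
        (fun s hs hy => by
          have := (hstrong.tangent hX hSX hM hpos (hcS hs) hy).1
          rw [hc.inner_deriv hpos hs] at this
          linarith)
        (fun s hs y hy => (hstrong.tangent hX hSX hM hpos (hcS hs) hy).2)
        (by rw [h1]; exact hz)
      refine ⟨0, ?_⟩
      rw [feasibleFeedback, mem_ofPred_eq, hm1, hm0, affineModel, affineModel, inner_add_right,
        inner_add_right, mulV_eq_sum_col, mulV_eq_sum_col, inner_sum, inner_sum]
      rw [h0] at hz0
      rw [h0, h1] at hle
      simpa [inner_smul_right, hz, hz0] using hle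
    · push Not at hz
      obtain ⟨j, hj⟩ := hz
      set a := inner ℝ (momentum (opField M) c 1) (col B j x) with ha
      -- `r` is the signed slack of the constraint at `v = 0`. The `j`-th input enters with slope `2
      -- * a`, so the value `r / (2 * a)` gives equality.
      set r := -2 * lam * riemEnergy X M xs x
        + 2 * inner ℝ (momentum (opField M) c 0) (affineModel f B xs us)
        - 2 * inner ℝ (momentum (opField M) c 1) (affineModel f B x us) with hr
      refine ⟨EuclideanSpace.single j (r / (2 * a)), ?_⟩
      have hcol : inner ℝ (momentum (opField M) c 1)
          (mulV (B x) (EuclideanSpace.single j (r / (2 * a)))) = r / 2 := by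
        rw [mulV_eq_sum_col, inner_sum, Finset.sum_eq_single j]
        · rw [inner_smul_right, ← ha]
          simp only [PiLp.single_apply, if_true]
          field_simp
        · intro i _ hi
          simp [hi]
        · simp
      rw [feasibleFeedback, mem_ofPred_eq, hm1, hm0]
      have : affineModel f B x (us + EuclideanSpace.single j (r / (2 * a)))
          = affineModel f B x us + mulV (B x) (EuclideanSpace.single j (r / (2 * a))) := by
        simp only [affineModel, mulV_add, add_assoc]
      rw [this, inner_add_right, hcol]
      linarith
  have hmem := (hu hfeas).1
  rw [feasibleFeedback, mem_ofPred_eq, hm1, hm0, add_sub_cancel] at hmem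
  exact hmem

end Controllers

/-! ### Norm estimates for the disturbance and the deviation. -/

section Bounds

variable {n m : ℕ}

theorem infMinEig_mul_le {M : Vec n → Matrix (Fin n) (Fin n) ℝ} {S : Set (Vec n)}
    (hpos : ∀ x ∈ S, (M x).PosDef) {x : Vec n} (hx : x ∈ S) (v : Vec n) :
    infMinEig M S * ‖v‖ ^ 2 ≤ inner ℝ v (opField M x v) := by
  have hbdd : BddBelow ((fun x => minEig (M x)) '' S) := by
    refine ⟨0, ?_⟩
    rintro _ ⟨z, hz, rfl⟩
    exact Real.sInf_nonneg
      (Matrix.posSemidef_iff_isHermitian_and_spectrum_nonneg.1 (hpos z hz).posSemidef).2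
  exact (mul_le_mul_of_nonneg_right (csInf_le hbdd ⟨x, hx, rfl⟩) (sq_nonneg _)).trans
    (minEig_mul_le (hpos x hx).isHermitian v)

theorem le_supMaxEig_mul {M : Vec n → Matrix (Fin n) (Fin n) ℝ} {S : Set (Vec n)}
    (hpos : ∀ x ∈ S, (M x).PosDef) (hbdd : BddAbove ((fun x => maxEig (M x)) '' S))
    {x : Vec n} (hx : x ∈ S) (v : Vec n) :
    inner ℝ v (opField M x v) ≤ supMaxEig M S * ‖v‖ ^ 2 :=
  (le_maxEig_mul (hpos x hx).isHermitian v).trans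
    (mul_le_mul_of_nonneg_right (le_csSup hbdd ⟨x, hx, rfl⟩) (sq_nonneg _))

/-- The Cauchy-Schwarz inequality for the metric. -/
theorem inner_le_sqrt_mul_sqrt {M : Vec n → Matrix (Fin n) (Fin n) ℝ} {x : Vec n}
    (hpos : (M x).PosDef) (v w : Vec n) :
    inner ℝ v (opField M x w) ≤
      Real.sqrt (inner ℝ v (opField M x v)) * Real.sqrt (inner ℝ w (opField M x w)) := by
  have hnn : ∀ y, 0 ≤ inner ℝ y (opField M x y) := inner_mulV_self_nonneg hpos.posSemidef
  have hsym : inner ℝ w (opField M x v) = inner ℝ v (opField M x w) := by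
    rw [← opField_symmetric hpos.isHermitian, real_inner_comm]
  -- The squared metric norm of `v + t w` is a nonnegative quadratic in `t`, so its discriminant is
  -- at most zero.
  have hquad : ∀ t : ℝ, 0 ≤ inner ℝ w (opField M x w) * (t * t)
      + 2 * inner ℝ v (opField M x w) * t + inner ℝ v (opField M x v) := fun t => by
    have := hnn (v + t • w)
    simp only [map_add, map_smul, inner_add_left, inner_add_right, inner_smul_left,
      inner_smul_right, hsym, conj_trivial] at this
    linarith
  have hdisc := discrim_le_zero hquad
  rw [← Real.sqrt_mul (hnn v)]
  refine Real.le_sqrt_of_sq_le ?_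
  rw [discrim] at hdisc
  linarith

/-- The distance of the end points of a minimizing geodesic, in terms of its energy. -/
theorem IsMinGeodesic.norm_sub_le {X S : Set (Vec n)} {M : Vec n → Matrix (Fin n) (Fin n) ℝ}
    (hSX : S ⊆ X) (hpos : ∀ x ∈ X, (M x).PosDef) (hmin : 0 < infMinEig M S)
    {p q : Vec n} {c : ℝ → Vec n} (hc : IsMinGeodesic X M p q c) (hcS : MapsTo c (Icc 0 1) S) :
    ‖q - p‖ ≤ Real.sqrt (riemEnergy X M p q) / Real.sqrt (infMinEig M S) := by
  have hd : ∀ s ∈ Icc (0 : ℝ) 1, HasDerivWithinAt c (deriv c s) (Icc 0 1) s := fun s _ =>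
    ((hc.1.1.differentiable (by simp) s).hasDerivAt).hasDerivWithinAt
  -- The constant metric speed `√E` bounds the Euclidean speed by `√E / √λ̲`.
  have := norm_image_sub_le_of_norm_deriv_le_segment_01'
    (C := Real.sqrt (riemEnergy X M p q) / Real.sqrt (infMinEig M S)) hd fun s hs => by
      have hs' := Ico_subset_Icc_self hs
      have h1 := infMinEig_mul_le (fun x hx => hpos x (hSX hx)) (hcS hs') (deriv c s)
      rw [hc.inner_deriv hpos hs'] at h1
      rw [le_div_iff₀ (Real.sqrt_pos.2 hmin), ← Real.sqrt_sq (norm_nonneg (deriv c s)),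
        ← Real.sqrt_mul (sq_nonneg _)]
      exact Real.sqrt_le_sqrt (by linarith)
  rwa [hc.1.2.1, hc.1.2.2.1] at this

theorem norm_pair_sub_le (x x' : Vec n) (u u' : Vec m) (z : Pair n m) :
    ‖pair x u - z‖ ≤ ‖pair x' u' - z‖ + ‖x - x'‖ + ‖u - u'‖ := by
  have hsplit : pair x u - z = (pair x' u' - z) + (pair (x - x') 0 + pair 0 (u - u')) := by
    have : pair x u = pair x' u' + (pair (x - x') 0 + pair 0 (u - u')) := by
      simp [pair, ← WithLp.toLp_add]
    rw [this]
    abel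
  have h1 : ‖pair (x - x') (0 : Vec m)‖ = ‖x - x'‖ := WithLp.norm_toLp_fst 2 _ _ _
  have h2 : ‖pair (0 : Vec n) (u - u')‖ = ‖u - u'‖ := WithLp.norm_toLp_snd 2 _ _ _
  rw [hsplit]
  refine (norm_add_le _ _).trans ?_
  have := norm_add_le (pair (x - x') (0 : Vec m)) (pair (0 : Vec n) (u - u'))
  rw [h1, h2] at this
  linarith

end Bounds

end CCM

end

/-! ### The differential inequality. -/

theorem mainTheorem2 {n m N : ℕ}
    -- state space, learned model `g = f + B u`, true dynamics `h`, metric, contraction rate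
    (X : Set (CCM.Vec n)) (f : CCM.Vec n → CCM.Vec n)
    (B : CCM.Vec n → Matrix (Fin n) (Fin m) ℝ)
    (h : CCM.Vec n → CCM.Vec m → CCM.Vec n)
    (M : CCM.Vec n → Matrix (Fin n) (Fin n) ℝ) (lam : ℝ)
    -- training data, radius of the trusted domain, Lipschitz constant of the model error
    (xd : Fin N → CCM.Vec n) (ud : Fin N → CCM.Vec m) (r : ℝ)
    (D : Set (CCM.Pair n m)) (hD : D = CCM.trustedDomain xd ud r)
    (L : ℝ≥0)
    (hL : LipschitzOnWith L (fun z : CCM.Pair n m => h z.fst z.snd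
      - CCM.affineModel f B z.fst z.snd) D)
    -- regularity
    (hX : IsOpen X) (hDX : CCM.stateProj D ⊆ X)
    (hf : ContDiffOn ℝ 1 f X)
    (hB : ∀ i j, ContDiffOn ℝ 1 (fun x => B x i j) X)
    (hM : ∀ i j, ContDiffOn ℝ 1 (fun x => M x i j) X)
    (hMpos : ∀ x ∈ X, (M x).PosDef)
    (hmax : BddAbove ((fun x => CCM.maxEig (M x)) '' CCM.stateProj D))
    (hmin : 0 < CCM.infMinEig M (CCM.stateProj D))
    -- nominal trajectory, executed trajectory, disturbance, feedback bound, on `[0, T)`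
    (T : ℝ) (xs x d : ℝ → CCM.Vec n) (us u : ℝ → CCM.Vec m) (ufb : ℝ → ℝ)
    (hnomD : ∀ t ∈ Ico 0 T, CCM.pair (xs t) (us t) ∈ D)
    (hnom : ∀ t ∈ Ico 0 T,
      HasDerivWithinAt xs (CCM.affineModel f B (xs t) (us t)) (Ici t) t)
    (hexec : ∀ t ∈ Ico 0 T,
      HasDerivWithinAt x (f (x t) + CCM.mulV (B (x t)) (u t) + d t) (Ici t) t)
    (hdist : ∀ t ∈ Ico 0 T,
      ‖d t‖ ≤ ⨅ i, CCM.errBound L h (CCM.affineModel f B) xd ud (CCM.pair (x t) (u t)) i)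
    (hufb : ∀ t ∈ Ico 0 T, ‖u t - us t‖ ≤ ufb t)
    -- minimizing geodesics from the nominal to the executed state, over the trusted domain
    (γ : ℝ → ℝ → CCM.Vec n)
    (hγ : ∀ t ∈ Ico 0 T, CCM.IsMinGeodesic X M (xs t) (x t) (γ t))
    (hγD : ∀ t ∈ Ico 0 T, MapsTo (γ t) (Icc 0 1) (CCM.stateProj D))
    -- the controller is contracting with rate `lam` in the metric `M`
    (hctrl :
      (∃ (κ : CCM.Vec n → CCM.Vec n → CCM.Vec m → CCM.Vec m) (εmax : ℝ),
        CCM.IsWeakContracting f B M lam D εmax κ ∧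
        ∀ t ∈ Ico 0 T, u t = κ (x t - xs t) (xs t) (us t) ∧
          ∀ s ∈ Icc (0 : ℝ) 1, ‖γ t s - xs t‖ < εmax)
      ∨
      (∃ (k : ℕ) (Bp : CCM.Vec n → Matrix (Fin n) (Fin k) ℝ),
        CCM.StrongConditions f B M lam (CCM.stateProj D) Bp ∧
        ∀ t ∈ Ico 0 T,
          CCM.IsMinNormFeedback f B M lam X (xs t) (x t) (us t) (γ t) (u t - us t))) :
    ∀ t ∈ Ico 0 T, ∀ i : Fin N,
      (IsMinOn (CCM.errBound L h (CCM.affineModel f B) xd ud (CCM.pair (x t) (u t))) univ i ∨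
        IsMinOn (CCM.errBound L h (CCM.affineModel f B) xd ud (CCM.pair (xs t) (us t))) univ i) →
      CCM.upperDini (fun τ => CCM.riemEnergy X M (xs τ) (x τ)) t ≤
        ((CCM.energyRHS lam L
          (CCM.supMaxEig M (CCM.stateProj D)) (CCM.infMinEig M (CCM.stateProj D))
          (CCM.riemEnergy X M (xs t) (x t))
          ‖CCM.pair (xs t) (us t) - CCM.pair (xd i) (ud i)‖
          (ufb t) (CCM.trainErr h (CCM.affineModel f B) xd ud i) : ℝ) : EReal) := by
  intro t ht i _
  have hγt := hγ t ht
  obtain ⟨hsm, h0, h1, hcX⟩ := hγt.1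
  have hposD : ∀ x ∈ CCM.stateProj D, (M x).PosDef := fun x hx => hMpos x (hDX hx)
  have hsymm : ∀ x ∈ X, ∀ v w,
      inner ℝ (CCM.opField M x v) w = inner ℝ v (CCM.opField M x w) :=
    fun x hx => CCM.opField_symmetric (hMpos x hx).isHermitian
  set E := CCM.riemEnergy X M (xs t) (x t) with hE
  set lmax := CCM.supMaxEig M (CCM.stateProj D) with hlmax
  set lmin := CCM.infMinEig M (CCM.stateProj D) with hlmin
  have hE0 : 0 ≤ E := sq_nonneg _
  have hbase : 2 * inner ℝ (CCM.momentum (CCM.opField M) (γ t) 1)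
        (CCM.affineModel f B (x t) (u t))
      - 2 * inner ℝ (CCM.momentum (CCM.opField M) (γ t) 0)
        (CCM.affineModel f B (xs t) (us t)) ≤ -2 * lam * E := by
    rcases hctrl with ⟨κ, εmax, hκ, hu⟩ | ⟨k, Bp, hstrong, hu⟩
    · rw [(hu t ht).1]
      exact hκ.boundary_le hX hf hB hM hMpos (hnomD t ht) hγt (hγD t ht) (hu t ht).2
    · exact (hu t ht).boundary_le hstrong hX hDX hf hB hM hMpos hγt (hγD t ht)
  have hdini := CCM.upperDini_le_of_eulerLagrange hX (CCM.contDiffOn_opField hM) hsymm hsm hcX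
    (hγt.eulerLagrange hX hM hMpos) (e := CCM.riemEnergy X M)
    (fun c hc hcX' => CCM.riemEnergy_le_curveEnergy hM hMpos hc hcX')
    (by rw [h0, h1, hγt.curveEnergy_eq hMpos]) h0.symm h1.symm (hnom t ht) (hexec t ht)
  refine hdini.trans (EReal.coe_le_coe_iff.2 ?_)
  have hdi : ‖d t‖ ≤ L * ‖CCM.pair (x t) (u t) - CCM.pair (xd i) (ud i)‖
      + CCM.trainErr h (CCM.affineModel f B) xd ud i :=
    (hdist t ht).trans (ciInf_le (finite_range _).bddBelow i)
  have htri := CCM.norm_pair_sub_le (x t) (xs t) (u t) (us t) (CCM.pair (xd i) (ud i))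
  have hxx := hγt.norm_sub_le hDX hMpos hmin (hγD t ht)
  have hd : ‖d t‖ ≤ L * (‖CCM.pair (xs t) (us t) - CCM.pair (xd i) (ud i)‖
      + √E / √lmin + ufb t) + CCM.trainErr h (CCM.affineModel f B) xd ud i := by
    refine hdi.trans ?_
    gcongr
    linarith [hufb t ht]
  -- The final velocity of the geodesic has metric norm `√E`, and `d` has metric norm at most `√λ̄
  -- ‖d‖`.
  have hcs : inner ℝ (CCM.momentum (CCM.opField M) (γ t) 1) (d t) ≤ √E * (√lmax * ‖d t‖) := by
    have h2 : (1 : ℝ) ∈ Icc (0 : ℝ) 1 := right_mem_Icc.2 zero_le_one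
    rw [CCM.momentum, hsymm _ (hcX h2)]
    refine (CCM.inner_le_sqrt_mul_sqrt (hMpos _ (hcX h2)) _ _).trans ?_
    rw [hγt.inner_deriv hMpos h2]
    gcongr
    calc √(inner ℝ (d t) (CCM.opField M (γ t 1) (d t)))
        ≤ √(lmax * ‖d t‖ ^ 2) :=
          Real.sqrt_le_sqrt (CCM.le_supMaxEig_mul hposD hmax (hγD t ht h2) (d t))
      _ = √lmax * ‖d t‖ := by
          rw [Real.sqrt_mul' _ (sq_nonneg _), Real.sqrt_sq (norm_nonneg _)]
  have hsplit : f (x t) + CCM.mulV (B (x t)) (u t) + d t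
      = CCM.affineModel f B (x t) (u t) + d t := rfl
  rw [hsplit, inner_add_right, CCM.energyRHS, Real.sqrt_mul hE0, Real.sqrt_div' _ hmin.le]
  have hfin : √E * (√lmax * ‖d t‖) ≤ √E * (√lmax *
      (L * (‖CCM.pair (xs t) (us t) - CCM.pair (xd i) (ud i)‖ + √E / √lmin + ufb t)
        + CCM.trainErr h (CCM.affineModel f B) xd ud i)) := by gcongr
  have hEE : √E * √E = E := Real.mul_self_sqrt hE0
  -- The deviation term `√E / √lmin` meets the outer factor `√E`, producing a multiple of `E` that
  -- is absorbed into the contraction rate.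
  have hexp : √E * (√lmax *
      (L * (‖CCM.pair (xs t) (us t) - CCM.pair (xd i) (ud i)‖ + √E / √lmin + ufb t)
        + CCM.trainErr h (CCM.affineModel f B) xd ud i)) =
      L * (√lmax / √lmin) * E + √E * √lmax *
        (L * (‖CCM.pair (xs t) (us t) - CCM.pair (xd i) (ud i)‖ + ufb t)
          + CCM.trainErr h (CCM.affineModel f B) xd ud i) := by
    linear_combination (√lmax * L / √lmin) * hEE
  linarith
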